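/- Let $d\ge 2$ and $\varepsilon>0$. For $n\ge 1$ let $\Lambda_n=\{0,\dots,n-1\}^d\subset\mathbb Z^d$, let $q\ge 1$ be a fixed integer, and let $(\sigma_v)_{v\in\Lambda_n}$ be i.i.d. labels, uniform on $\{1,\dots,q\}$. Let $r=r(n)$ be positive integers such that, for all large $n$, $2r\le n$ and $q^{r^d}\ge n^{d(1+\varepsilon)}$. An $s$-box is a translate of $\Lambda_s$. An $(r-1)$-box $A\subset\Lambda_n$ is *unique* if there is no other translate $A+t\subset\Lambda_n$, $A+t\neq A$, with $\sigma_{x+t}=\sigma_x$ for all $x\in A$. A $2r$-box $B\subset\Lambda_n$ is *open* if every $(r-1)$-box contained in $B$ is unique. Let $\mathcal B_{2r}$ be the collection of $2r$-boxes contained in $\Lambda_n$ for which each coordinate of the largest corner vertex equals $n-1$ or is of the form $kr+(r-1)$ with $k\in\mathbb Z$. Boxes $B,B'\in\mathcal B_{2r}$ are *strongly neighboring* if $|B\cap B'|\ge r^d$, and *weakly neighboring* if $\min_{u\in B,v\in B'}|u-v|_\infty\le 4r$. Let $\mathcal C_{2r}$ be the collection of $B\in\mathcal B_{2r}$ for which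 there is a sequence of open boxes of $\mathcal B_{2r}$, starting with $\Lambda_{2r}$ and ending with $B$ (both open), in which consecutive boxes are strongly neighboring. The weakly connected components of $\mathcal B_{2r}\setminus\mathcal C_{2r}$ are its connected components for the weakly neighboring relation, and the diameter of a component is the $\ell_\infty$-diameter of the union of its boxes. Then there is a constant $\kappa=\kappa(d,\varepsilon)$, depending only on $d$ and $\varepsilon$ (so not on $n$, $q$ or the sequence $r$), such that, with probability tending to $1$ as $n\to\infty$, each weakly connected component of $\mathcal B_{2r}\setminus\mathcal C_{2r}$ has diameter at most $\kappa r$. In addition, for every constant $\kappa'$, with probability tending to $1$ as $n\to\infty$, $$\{v\in\Lambda_n:\ v_i\notin(\kappa' r,\,n-\kappa' r)\ \text{for all } 1\le i\le d\}\ \subset\ \bigcup_{B\in\mathcal C_{2r}}B .$$ -/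

import Mathlib

open scoped Pointwise

namespace Shotgun

/-- The box of side length `s` in `ℤ^d` with smallest corner `a`. -/
noncomputable def box {d : ℕ} (a : Fin d → ℤ) (s : ℕ) : Finset (Fin d → ℤ) :=
  Fintype.piFinset fun i => Finset.Ico (a i) (a i + s)

/-- `Λ_n = {0, …, n-1}^d`. -/
noncomputable def Lam (d n : ℕ) : Finset (Fin d → ℤ) := box 0 n

/-- The collection of all `s`-boxes contained in `Λ_n`. -/
noncomputable def boxes (d n s : ℕ) : Set (Finset (Fin d → ℤ)) :=
  {B | (∃ a : Fin d → ℤ, B = box a s) ∧ B ⊆ Lam d n}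

/-- Labeling configurations on `Λ_n` with `q` labels. -/
abbrev Labeling (d q n : ℕ) : Type := ↥(Lam d n) → Fin q

/-- The law of i.i.d. uniform labels on the vertices of `Λ_n`. -/
noncomputable def labelLaw (d q n : ℕ) : MeasureTheory.Measure (Labeling d q n) :=
  MeasureTheory.Measure.pi fun _ => ProbabilityTheory.uniformOn (Set.univ : Set (Fin q))

/-- `B` is unique: no translate of `B` inside `Λ_n`, other than `B` itself,
carries the same labels as `B` does. -/
def IsUnique {d q n : ℕ} (σ : Labeling d q n) (B : Finset (Fin d → ℤ)) : Prop :=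
  ∀ t : Fin d → ℤ, t +ᵥ B ≠ B → t +ᵥ B ⊆ Lam d n →
    ∃ x y : ↥(Lam d n), x.1 ∈ B ∧ y.1 = t + x.1 ∧ σ x ≠ σ y

/-- `B` is open (at scale `r`): every `(r-1)`-box contained in `B` is unique. -/
def IsOpenBox {d q n : ℕ} (r : ℕ) (σ : Labeling d q n) (B : Finset (Fin d → ℤ)) : Prop :=
  ∀ B' ∈ boxes d n (r - 1), B' ⊆ B → IsUnique σ B'

/-- The `2r`-boxes `B ⊆ Λ_n` for which each coordinate of the largest corner vertex is either
`n - 1` or of the form `k r + (r - 1)` with an integer `k`. -/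
def gridBoxes (d n r : ℕ) : Set (Finset (Fin d → ℤ)) :=
  {B | B ⊆ Lam d n ∧ ∃ a : Fin d → ℤ, B = box a (2 * r) ∧
    ∀ i, a i + 2 * (r : ℤ) - 1 = (n : ℤ) - 1 ∨
      ∃ k : ℤ, a i + 2 * (r : ℤ) - 1 = k * (r : ℤ) + ((r : ℤ) - 1)}

def StrongNeighbor {d : ℕ} (r : ℕ) (B B' : Finset (Fin d → ℤ)) : Prop :=
  r ^ d ≤ (B ∩ B').card

/-- The distance of `Fin d → ℤ` is the `ℓ_∞` distance. -/
def WeakNeighbor {d : ℕ} (r : ℕ) (B B' : Finset (Fin d → ℤ)) : Prop :=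
  ∃ u ∈ B, ∃ v ∈ B', dist u v ≤ 4 * (r : ℝ)

/-- `x` and `y` are joined by a finite sequence of elements of `S` (both ends included) in which
consecutive elements are related by `R`. -/
def JoinedWithin {α : Type*} (S : Set α) (R : α → α → Prop) (x y : α) : Prop :=
  x ∈ S ∧ Relation.ReflTransGen (fun a b => b ∈ S ∧ R a b) x y

/-- The grid boxes that are connected to `Λ_{2r}` by a sequence of strongly neighboring open
grid boxes. -/
def cluster {d q n : ℕ} (r : ℕ) (σ : Labeling d q n) : Set (Finset (Fin d → ℤ)) :=
  {B | JoinedWithin {B' | B' ∈ gridBoxes d n r ∧ IsOpenBox r σ B'} (StrongNeighbor r)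
    (Lam d (2 * r)) B}

/-- The weakly connected component of `B` in the collection `S` of boxes. -/
def weakComponent {d : ℕ} (r : ℕ) (S : Set (Finset (Fin d → ℤ))) (B : Finset (Fin d → ℤ)) :
    Set (Finset (Fin d → ℤ)) :=
  {B' | JoinedWithin S (WeakNeighbor r) B B'}

/-- The set of vertices covered by a collection of boxes. -/
def vertexSet {d : ℕ} (S : Set (Finset (Fin d → ℤ))) : Set (Fin d → ℤ) :=
  {v | ∃ B ∈ S, v ∈ B}

/-- The vertices of `Λ_n` all of whose coordinates lie outside `(c r, n - c r)`. -/
def corner (d n r : ℕ) (c : ℝ) : Set (Fin d → ℤ) :=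
  {v | v ∈ Lam d n ∧ ∀ i, (v i : ℝ) ∉ Set.Ioo (c * r) (n - c * r)}

end Shotgun

/-!
Write `C` for the cluster and identify grid boxes with their smallest corners, the "grid corners".
Boxes whose corners differ by at most `r` in every coordinate are strongly neighboring, so every
grid corner outside `C` adjacent to `C` at scale `r` is closed, that is, the corner of a box that is
not open.

*Topology.* Let `S` be a weak component of the complement of `C`. Both `S` and its complement are
weakly connected, and every boundary point of `S` has a closed corner nearby. The boundary of `S` is
connected at scale `7 r` (`Shotgun.forall_innerBoundary_of_propagates`): the boundary edges in one
of its pieces form a `ℤ/2`-cocycle, since its sum around short quadrilaterals vanishes;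
the grid is contracted by truncating coordinates, so the cocycle has a primitive
(`Shotgun.exists_primitive`), which is constant on `S` and on its complement; so the piece is empty
or the whole boundary. A boundary of large diameter therefore meets `K` concentric annuli, which
produces `K` closed corners far from each other within a ball of radius `30 K r`
(`Shotgun.HasSpread`). If this happens nowhere, the boundary lies in a ball of radius `30 K r`; for
`2 ≤ d` the outside of a ball is connected, so `S` or `C` lies in the ball, and the latter is
impossible when all boxes near the origin are open (`Shotgun.cornerComponent_near`). If moreover
all boxes near all corners of `Λ_n` are open, no component reaches a corner of `Λ_n`
(`Shotgun.mem_of_near_open_corner`).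

*Probability.* A closed box contains an `(r-1)`-box whose labels are repeated on a translate. From
`2 k` closed boxes far from each other one extracts `k` repeated boxes such that each translate
avoids the boxes preceding it (`Shotgun.hasMatches_of_hasSpread`). The labels on these `k` boxes
are then determined by the remaining ones (`Shotgun.eq_of_matches`), so given translates match
with probability at most `q ^ (-k (r-1)^d)`. The number of choices for one box and its translate,
times `q ^ (-(r-1)^d)`, is at most `n ^ (-dε/4)` for large `n` (`Shotgun.eventually_count_div_le`).
A union bound over the `n ^ d` locations succeeds once `k > 4/ε`; this fixes `K = 2 k` and `κ`.
-/

namespace Shotgun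

/-! ### The grid of box corners -/

/-- `a` and `b` are at `ℓ_∞` distance at most `ℓ`. -/
def Near {d : ℕ} (ℓ : ℤ) (a b : Fin d → ℤ) : Prop := ∀ i, |a i - b i| ≤ ℓ

theorem Near.symm {d : ℕ} {ℓ : ℤ} {a b : Fin d → ℤ} (h : Near ℓ a b) : Near ℓ b a :=
  fun i => by rw [abs_sub_comm]; exact h i

theorem Near.trans {d : ℕ} {ℓ ℓ' : ℤ} {a b c : Fin d → ℤ} (h : Near ℓ a b) (h' : Near ℓ' b c) :
    Near (ℓ + ℓ') a c :=
  fun i => (abs_sub_le (a i) (b i) (c i)).trans (add_le_add (h i) (h' i))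

theorem Near.mono {d : ℕ} {ℓ ℓ' : ℤ} {a b : Fin d → ℤ} (h : Near ℓ a b) (hl : ℓ ≤ ℓ') :
    Near ℓ' a b :=
  fun i => (h i).trans hl

theorem Near.refl {d : ℕ} {ℓ : ℤ} (hl : 0 ≤ ℓ) (a : Fin d → ℤ) : Near ℓ a a :=
  fun i => by simpa using hl

/-- The smallest corners of the boxes in `gridBoxes d n r`. -/
def gridCorners (d n r : ℕ) : Set (Fin d → ℤ) :=
  {a | ∀ i, 0 ≤ a i ∧ a i ≤ (n : ℤ) - 2 * r ∧ (a i = (n : ℤ) - 2 * r ∨ (r : ℤ) ∣ a i)}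

theorem mem_box {d : ℕ} {a x : Fin d → ℤ} {s : ℕ} :
    x ∈ box a s ↔ ∀ i, a i ≤ x i ∧ x i < a i + s := by
  simp [box]

theorem mem_Lam {d n : ℕ} {x : Fin d → ℤ} : x ∈ Lam d n ↔ ∀ i, 0 ≤ x i ∧ x i < n := by
  simp [Lam, mem_box]

theorem left_mem_box {d : ℕ} (a : Fin d → ℤ) {s : ℕ} (hs : 0 < s) : a ∈ box a s :=
  mem_box.2 fun i => ⟨le_rfl, by omega⟩

theorem box_injective {d s : ℕ} (hs : 0 < s) :
    Function.Injective fun a : Fin d → ℤ => box a s := by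
  intro a b h
  change box a s = box b s at h
  have h1 := mem_box.1 (h ▸ left_mem_box a hs)
  have h2 := mem_box.1 (h ▸ left_mem_box b hs)
  funext i
  exact le_antisymm (h2 i).1 (h1 i).1

theorem box_subset_Lam {d n s : ℕ} (hs : 0 < s) {a : Fin d → ℤ} :
    box a s ⊆ Lam d n ↔ ∀ i, 0 ≤ a i ∧ a i + s ≤ n := by
  constructor
  · intro h i
    have h1 := mem_Lam.1 (h (left_mem_box a hs)) i
    have h2 : (fun i => a i + (s : ℤ) - 1) ∈ box a s :=
      mem_box.2 fun i => ⟨by omega, by omega⟩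
    have h3 := mem_Lam.1 (h h2) i
    grind
  · intro h x hx
    refine mem_Lam.2 fun i => ?_
    have := mem_box.1 hx i
    have := h i
    omega

theorem mem_gridBoxes {d n r : ℕ} (hr : 0 < r) {B : Finset (Fin d → ℤ)} :
    B ∈ gridBoxes d n r ↔ ∃ a ∈ gridCorners d n r, B = box a (2 * r) := by
  constructor
  · rintro ⟨hB, a, rfl, ha⟩
    refine ⟨a, fun i => ?_, rfl⟩
    have h := (box_subset_Lam (by omega)).1 hB i
    push_cast at h
    refine ⟨h.1, by omega, (ha i).imp (fun h => by omega) ?_⟩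
    rintro ⟨k, hk⟩
    exact ⟨k - 1, by linear_combination hk⟩
  · rintro ⟨a, ha, rfl⟩
    refine ⟨(box_subset_Lam (by omega)).2 fun i => ?_, a, rfl, fun i => ?_⟩
    · have := ha i
      push_cast
      omega
    · refine (ha i).2.2.imp (fun h => by omega) ?_
      rintro ⟨k, hk⟩
      exact ⟨k + 1, by rw [hk]; ring⟩

theorem box_mem_gridBoxes {d n r : ℕ} (hr : 0 < r) {a : Fin d → ℤ} :
    box a (2 * r) ∈ gridBoxes d n r ↔ a ∈ gridCorners d n r := by
  rw [mem_gridBoxes hr]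
  constructor
  · rintro ⟨b, hb, h⟩
    rwa [box_injective (s := 2 * r) (by omega) h]
  · exact fun h => ⟨a, h, rfl⟩

theorem weakNeighbor_box {d r : ℕ} (hr : 0 < r) {a b : Fin d → ℤ} :
    WeakNeighbor r (box a (2 * r)) (box b (2 * r)) ↔ Near (6 * r - 1) a b := by
  have hdist : ∀ u v : Fin d → ℤ, dist u v ≤ 4 * (r : ℝ) ↔ Near (4 * r) u v := by
    intro u v
    rw [dist_pi_le_iff (by positivity)]
    refine forall_congr' fun i => ?_
    rw [Int.dist_eq]
    exact_mod_cast Iff.rfl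
  constructor
  · rintro ⟨u, hu, v, hv, huv⟩ i
    have h1 := mem_box.1 hu i
    have h2 := mem_box.1 hv i
    have h3 := abs_le.1 ((hdist u v).1 huv i)
    push_cast at h1 h2
    rw [abs_le]
    omega
  · intro h
    -- on each axis the interval lying to the left contributes its last point, the other its first
    refine ⟨fun i => if a i ≤ b i then min (a i + 2 * r - 1) (b i) else a i, mem_box.2 fun i => ?_,
      fun i => if a i ≤ b i then b i else min (b i + 2 * r - 1) (a i), mem_box.2 fun i => ?_,
      (hdist _ _).2 fun i => ?_⟩
    · push_cast
      split_ifs <;> omega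
    · push_cast
      split_ifs <;> omega
    · have := abs_le.1 (h i)
      rw [abs_le]
      split_ifs <;> omega

theorem StrongNeighbor.weakNeighbor {d r : ℕ} (hr : 0 < r) {B B' : Finset (Fin d → ℤ)}
    (h : StrongNeighbor r B B') : WeakNeighbor r B B' := by
  have hpos : 0 < (B ∩ B').card := lt_of_lt_of_le (by positivity) h
  obtain ⟨u, hu⟩ := Finset.card_pos.1 hpos
  rw [Finset.mem_inter] at hu
  exact ⟨u, hu.1, u, hu.2, by rw [dist_self]; positivity⟩

theorem card_box {d : ℕ} (a : Fin d → ℤ) (s : ℕ) : (box a s).card = s ^ d := by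
  simp [box, Fintype.card_piFinset]

theorem strongNeighbor_box {d r : ℕ} {a b : Fin d → ℤ} (h : Near r a b) :
    StrongNeighbor r (box a (2 * r)) (box b (2 * r)) := by
  have hsub : box (a ⊔ b) r ⊆ box a (2 * r) ∩ box b (2 * r) := by
    intro x hx
    rw [mem_box] at hx
    rw [Finset.mem_inter, mem_box, mem_box]
    constructor <;> intro i <;> have h1 := hx i <;> have h2 := abs_le.1 (h i) <;>
      rw [Pi.sup_apply] at h1 <;> push_cast <;> omega
  have := Finset.card_le_card hsub
  rwa [card_box] at this

theorem inf_mem_gridCorners {d n r : ℕ} {a b : Fin d → ℤ} (ha : a ∈ gridCorners d n r)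
    (hb : b ∈ gridCorners d n r) : a ⊓ b ∈ gridCorners d n r := by
  intro i
  rw [Pi.inf_apply]
  rcases min_choice (a i) (b i) with h | h <;> rw [h]
  exacts [ha i, hb i]

theorem sup_mem_gridCorners {d n r : ℕ} {a b : Fin d → ℤ} (ha : a ∈ gridCorners d n r)
    (hb : b ∈ gridCorners d n r) : a ⊔ b ∈ gridCorners d n r := by
  intro i
  rw [Pi.sup_apply]
  rcases max_choice (a i) (b i) with h | h <;> rw [h]
  exacts [ha i, hb i]

/-- The truncation of the coordinates of `x` at height `t r`. As `t` decreases, these maps contract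
the grid onto its smallest point by steps of size at most `r`. -/
def truncate {d : ℕ} (r t : ℕ) (x : Fin d → ℤ) : Fin d → ℤ := fun i => min (x i) (t * r)

theorem truncate_mem_gridCorners {d n r : ℕ} (t : ℕ) {x : Fin d → ℤ}
    (hx : x ∈ gridCorners d n r) : truncate r t x ∈ gridCorners d n r := by
  intro i
  obtain ⟨h1, h2, h3⟩ := hx i
  have h0 : (0 : ℤ) ≤ t * r := by positivity
  unfold truncate
  rcases le_total (x i) (t * r) with h | h
  · rw [min_eq_left h]
    exact ⟨h1, h2, h3⟩
  · rw [min_eq_right h]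
    exact ⟨h0, h.trans h2, Or.inr (dvd_mul_left _ _)⟩

theorem near_truncate_succ {d : ℕ} (r t : ℕ) (x : Fin d → ℤ) :
    Near r (truncate r t x) (truncate r (t + 1) x) := by
  intro i
  have h : ((t + 1 : ℕ) : ℤ) * r = t * r + r := by push_cast; ring
  rw [abs_le]
  unfold truncate
  rw [h]
  omega

theorem Near.truncate {d : ℕ} {ℓ : ℤ} {x y : Fin d → ℤ} (h : Near ℓ x y) (r t : ℕ) :
    Near ℓ (truncate r t x) (truncate r t y) := by
  intro i
  have h1 := abs_le.1 (h i)
  rw [abs_le]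
  unfold Shotgun.truncate
  omega

theorem truncate_zero {d n r : ℕ} {x : Fin d → ℤ} (hx : x ∈ gridCorners d n r) :
    truncate r 0 x = 0 := by
  funext i
  have := (hx i).1
  simpa [truncate] using this

theorem truncate_self {d n r : ℕ} (hr : 0 < r) {x : Fin d → ℤ} (hx : x ∈ gridCorners d n r) :
    truncate r n x = x := by
  funext i
  have h1 := (hx i).2.1
  have h2 : (n : ℤ) * 1 ≤ n * r := by gcongr; exact_mod_cast hr
  unfold truncate
  omega

theorem exists_succ_switch {p : ℕ → Prop} {m : ℕ} (h0 : p 0) (hm : ¬ p m) :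
    ∃ t, p t ∧ ¬ p (t + 1) := by
  by_contra! h
  exact hm (Nat.rec h0 (fun t ht => h t ht) m)

theorem exists_switch_of_le {d n r : ℕ} (hr : 0 < r) (P : (Fin d → ℤ) → Prop) {x y : Fin d → ℤ}
    (hx : x ∈ gridCorners d n r) (hy : y ∈ gridCorners d n r) (hxy : x ≤ y)
    (hPx : P x) (hPy : ¬ P y) :
    ∃ z ∈ gridCorners d n r, ∃ z' ∈ gridCorners d n r, P z ∧ ¬ P z' ∧ Near r z z' ∧
      z ∈ Set.Icc x y ∧ z' ∈ Set.Icc x y := by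
  have hstep : ∀ t, x ⊔ truncate r t y ∈ gridCorners d n r := fun t =>
    sup_mem_gridCorners hx (truncate_mem_gridCorners t hy)
  have hle : ∀ t, x ⊔ truncate r t y ∈ Set.Icc x y := fun t =>
    ⟨le_sup_left, sup_le hxy fun i => min_le_left _ _⟩
  have h0 : x ⊔ truncate r 0 y = x := by
    rw [truncate_zero hy]
    exact sup_eq_left.2 fun i => (hx i).1
  have hn : x ⊔ truncate r n y = y := by
    rw [truncate_self hr hy]
    exact sup_eq_right.2 hxy
  obtain ⟨t, ht, ht'⟩ := exists_succ_switch (p := fun t => P (x ⊔ truncate r t y)) (m := n)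
    (by simpa only [h0] using hPx) (by simpa only [hn] using hPy)
  refine ⟨_, hstep t, _, hstep (t + 1), ht, ht', fun i => ?_, hle t, hle (t + 1)⟩
  have := abs_le.1 (near_truncate_succ r t y i)
  rw [abs_le, Pi.sup_apply, Pi.sup_apply]
  omega

/-- Discrete intermediate value theorem on the grid: between a point with a property and a point
without it there are two adjacent such points, inside the box spanned by the two points. -/
theorem exists_switch {d n r : ℕ} (hr : 0 < r) (P : (Fin d → ℤ) → Prop) {x y : Fin d → ℤ}
    (hx : x ∈ gridCorners d n r) (hy : y ∈ gridCorners d n r) (hPx : P x) (hPy : ¬ P y) :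
    ∃ z ∈ gridCorners d n r, ∃ z' ∈ gridCorners d n r, P z ∧ ¬ P z' ∧ Near r z z' ∧
      z ∈ Set.Icc (x ⊓ y) (x ⊔ y) ∧ z' ∈ Set.Icc (x ⊓ y) (x ⊔ y) := by
  have hm := inf_mem_gridCorners hx hy
  by_cases h : P (x ⊓ y)
  · obtain ⟨z, hz, z', hz', h1, h2, h3, h4, h5⟩ :=
      exists_switch_of_le hr P hm hy inf_le_right h hPy
    exact ⟨z, hz, z', hz', h1, h2, h3, ⟨h4.1, h4.2.trans le_sup_right⟩,
      ⟨h5.1, h5.2.trans le_sup_right⟩⟩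
  · obtain ⟨z, hz, z', hz', h1, h2, h3, h4, h5⟩ :=
      exists_switch_of_le hr (fun a => ¬ P a) hm hx inf_le_left h (not_not.2 hPx)
    exact ⟨z', hz', z, hz, not_not.1 h2, h1, h3.symm, ⟨h5.1, h5.2.trans le_sup_left⟩,
      ⟨h4.1, h4.2.trans le_sup_left⟩⟩

/-! ### Connectedness of the boundary -/

/-- A set of grid corners is connected for the weak neighbor relation. The encoding is
cohomological: every locally constant function with values in `ℤ/2` is constant. -/
def WeaklyConnected {d : ℕ} (r : ℕ) (S : Set (Fin d → ℤ)) : Prop :=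
  ∀ ψ : (Fin d → ℤ) → ZMod 2, (∀ x ∈ S, ∀ y ∈ S, Near (6 * r - 1) x y → ψ x = ψ y) →
    ∀ x ∈ S, ∀ y ∈ S, ψ x = ψ y

/-- The points of `S` with a weak neighbor in the grid outside `S`. -/
def innerBoundary {d : ℕ} (n r : ℕ) (S : Set (Fin d → ℤ)) : Set (Fin d → ℤ) :=
  {x | x ∈ S ∧ ∃ y ∈ gridCorners d n r, y ∉ S ∧ Near (6 * r - 1) x y}

/-- A `ℤ/2`-valued cochain that vanishes on the diagonal and sums to zero around all quadrilaterals
with two sides of length at most `r` is the coboundary of a function. The function is obtained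
by integrating along the contraction of the grid by truncations. -/
theorem exists_primitive {d n r : ℕ} (hr : 0 < r) (φ : (Fin d → ℤ) → (Fin d → ℤ) → ZMod 2)
    (hdiag : ∀ a, φ a a = 0)
    (hφ : ∀ a ∈ gridCorners d n r, ∀ a' ∈ gridCorners d n r, ∀ b ∈ gridCorners d n r,
      ∀ b' ∈ gridCorners d n r, Near r a a' → Near r b b' → Near (6 * r - 1) a b →
      Near (6 * r - 1) a' b' → φ a a' + φ a' b' = φ a b + φ b b') :
    ∃ ψ : (Fin d → ℤ) → ZMod 2, ∀ x ∈ gridCorners d n r, ∀ y ∈ gridCorners d n r,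
      Near (6 * r - 1) x y → ψ x + φ x y = ψ y := by
  refine ⟨fun x => ∑ t ∈ Finset.range n, φ (truncate r t x) (truncate r (t + 1) x),
    fun x hx y hy hxy => ?_⟩
  have key : ∀ m : ℕ,
      (∑ t ∈ Finset.range m, φ (truncate r t x) (truncate r (t + 1) x)) +
        φ (truncate r m x) (truncate r m y) =
      ∑ t ∈ Finset.range m, φ (truncate r t y) (truncate r (t + 1) y) := by
    intro m
    induction m with
    | zero => simp [truncate_zero hx, truncate_zero hy, hdiag]
    | succ m ih =>
      rw [Finset.sum_range_succ, Finset.sum_range_succ, ← ih, add_assoc, add_assoc]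
      congr 1
      exact hφ _ (truncate_mem_gridCorners m hx) _ (truncate_mem_gridCorners _ hx) _
        (truncate_mem_gridCorners m hy) _ (truncate_mem_gridCorners _ hy)
        (near_truncate_succ r m x) (near_truncate_succ r m y) (hxy.truncate r m)
        (hxy.truncate r (m + 1))
  have := key n
  rwa [truncate_self hr hx, truncate_self hr hy] at this

open Classical in
/-- The boundary of a weakly connected set with weakly connected complement is connected at
scale `7 r`: a property of its points that propagates over distances up to `7 r` holds everywhere
once it holds somewhere. The boundary edges with the property form a `ℤ/2`-cocycle; for a
primitive `ψ`, connectedness makes `ψ` constant on both sides of the boundary, so that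
either all or none of the boundary edges have the property. -/
theorem forall_innerBoundary_of_propagates {d n r : ℕ} (hr : 0 < r) {S : Set (Fin d → ℤ)}
    (hSV : S ⊆ gridCorners d n r) (hS : WeaklyConnected r S)
    (hSc : WeaklyConnected r (gridCorners d n r \ S)) {T : (Fin d → ℤ) → Prop}
    (hT : ∀ x ∈ innerBoundary n r S, ∀ x' ∈ innerBoundary n r S, Near (7 * r) x x' → T x → T x')
    {x₀ : Fin d → ℤ} (hx₀ : x₀ ∈ innerBoundary n r S) (hTx₀ : T x₀) :
    ∀ x ∈ innerBoundary n r S, T x := by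
  intro x₁ hx₁
  by_contra hTx₁
  let ind : (Fin d → ℤ) → ZMod 2 := fun a => if a ∈ S then 1 else 0
  let φ : (Fin d → ℤ) → (Fin d → ℤ) → ZMod 2 := fun a b =>
    if (a ∈ S ∧ b ∉ S ∧ T a) ∨ (b ∈ S ∧ a ∉ S ∧ T b) then 1 else 0
  have hdiag : ∀ a, φ a a = 0 := fun a => if_neg (by tauto)
  obtain ⟨ψ, hψ⟩ := exists_primitive (n := n) hr φ hdiag (by
    intro a ha a' ha' b hb b' hb' haa' hbb' hab hab'
    -- points of the quadrilateral lie within `7 r` of each other, so that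
    -- its boundary points all have the property or all lack it
    have hr' : (1 : ℤ) ≤ r := by exact_mod_cast hr
    have n1 : Near (6 * r - 1) a a' := haa'.mono (by omega)
    have n2 : Near (6 * r - 1) b b' := hbb'.mono (by omega)
    let Q : Set (Fin d → ℤ) := {a, a', b, b'}
    have hQ : ∀ x ∈ Q, ∀ y ∈ Q, Near (7 * r) x y := by
      have m0 : ∀ x : Fin d → ℤ, Near (7 * r) x x := Near.refl (by omega)
      have m1 : Near (7 * r) a a' := haa'.mono (by omega)
      have m2 : Near (7 * r) b b' := hbb'.mono (by omega)
      have m3 : Near (7 * r) a b := hab.mono (by omega)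
      have m4 : Near (7 * r) a' b' := hab'.mono (by omega)
      have m5 : Near (7 * r) a b' := (haa'.trans hab').mono (by omega)
      have m6 : Near (7 * r) a' b := (haa'.symm.trans hab).mono (by omega)
      intro x hx y hy
      simp only [Q, Set.mem_insert_iff, Set.mem_singleton_iff] at hx hy
      rcases hx with h | h | h | h <;> rcases hy with h' | h' | h' | h' <;> rw [h, h'] <;>
        with_reducible first | exact m0 _ | assumption | (apply Near.symm; assumption)
    have hφ : ∀ x ∈ Q, ∀ y ∈ Q, ∀ z ∈ Q, x ∈ gridCorners d n r → y ∈ gridCorners d n r →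
        Near (6 * r - 1) x y → z ∈ innerBoundary n r S →
        φ x y = if T z then ind x + ind y else 0 := by
      intro x hx y hy z hz hxV hyV hxy hzS
      have two : (1 : ZMod 2) + 1 = 0 := by decide
      have hTx : x ∈ innerBoundary n r S → (T x ↔ T z) := fun h =>
        ⟨hT x h z hzS (hQ x hx z hz), hT z hzS x h (hQ z hz x hx)⟩
      have hTy : y ∈ innerBoundary n r S → (T y ↔ T z) := fun h =>
        ⟨hT y h z hzS (hQ y hy z hz), hT z hzS y h (hQ z hz y hy)⟩
      by_cases hxS : x ∈ S <;> by_cases hyS : y ∈ S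
      · simp [φ, ind, hxS, hyS, two]
      · simp [φ, ind, hxS, hyS, hTx ⟨hxS, y, hyV, hyS, hxy⟩]
      · simp [φ, ind, hxS, hyS, hTy ⟨hyS, x, hxV, hxS, hxy.symm⟩]
      · simp [φ, ind, hxS, hyS]
    by_cases hz : ∃ z ∈ Q, z ∈ innerBoundary n r S
    · obtain ⟨z, hzQ, hzS⟩ := hz
      have qa : a ∈ Q := by simp [Q]
      have qa' : a' ∈ Q := by simp [Q]
      have qb : b ∈ Q := by simp [Q]
      have qb' : b' ∈ Q := by simp [Q]
      rw [hφ a qa a' qa' z hzQ ha ha' n1 hzS, hφ a' qa' b' qb' z hzQ ha' hb' hab' hzS,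
        hφ a qa b qb z hzQ ha hb hab hzS, hφ b qb b' qb' z hzQ hb hb' n2 hzS]
      have two : (2 : ZMod 2) = 0 := by decide
      split_ifs
      · linear_combination (ind a' - ind b) * two
      · rfl
    · have hzero : ∀ x ∈ Q, ∀ y ∈ Q, x ∈ gridCorners d n r → y ∈ gridCorners d n r →
          Near (6 * r - 1) x y → φ x y = 0 := by
        intro x hx y hy hxV hyV hxy
        refine if_neg ?_
        rintro (⟨h1, h2, -⟩ | ⟨h1, h2, -⟩)
        · exact hz ⟨x, hx, h1, y, hyV, h2, hxy⟩
        · exact hz ⟨y, hy, h1, x, hxV, h2, hxy.symm⟩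
      rw [hzero a (by simp [Q]) a' (by simp [Q]) ha ha' n1,
        hzero a' (by simp [Q]) b' (by simp [Q]) ha' hb' hab',
        hzero a (by simp [Q]) b (by simp [Q]) ha hb hab,
        hzero b (by simp [Q]) b' (by simp [Q]) hb hb' n2])
  have hconst : ∀ U : Set (Fin d → ℤ), U ⊆ gridCorners d n r → (U ⊆ S ∨ ∀ x ∈ U, x ∉ S) →
      WeaklyConnected r U → ∀ x ∈ U, ∀ y ∈ U, ψ x = ψ y := by
    intro U hU hUS hconn
    refine hconn ψ fun x hx y hy hxy => ?_
    rw [← hψ x (hU hx) y (hU hy) hxy]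
    have : φ x y = 0 := if_neg (by
      rcases hUS with h | h
      · have := h hx; have := h hy; tauto
      · have := h x hx; have := h y hy; tauto)
    rw [this, add_zero]
  obtain ⟨h0S, y₀, hy₀, hy₀S, hxy₀⟩ := hx₀
  obtain ⟨h1S, y₁, hy₁, hy₁S, hxy₁⟩ := hx₁
  have h1 := hψ x₀ (hSV h0S) y₀ hy₀ hxy₀
  have h2 := hψ x₁ (hSV h1S) y₁ hy₁ hxy₁
  rw [show φ x₀ y₀ = 1 from if_pos (Or.inl ⟨h0S, hy₀S, hTx₀⟩)] at h1
  rw [show φ x₁ y₁ = 0 from if_neg (by tauto), add_zero,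
    hconst S hSV (Or.inl subset_rfl) hS x₁ h1S x₀ h0S,
    hconst _ Set.sdiff_subset (Or.inr fun x hx => hx.2) hSc y₁ ⟨hy₁, hy₁S⟩ y₀ ⟨hy₀, hy₀S⟩] at h2
  rw [h2] at h1
  exact one_ne_zero (add_eq_left.1 h1)

/-! ### Weak components of the complement of a cluster -/

/-- The weakly connected component of `a` in the set `U` of grid corners. -/
def cornerComponent {d : ℕ} (r : ℕ) (U : Set (Fin d → ℤ)) (a : Fin d → ℤ) : Set (Fin d → ℤ) :=
  {b | JoinedWithin U (Near (6 * r - 1)) a b}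

section Component

variable {d n r : ℕ} {U : Set (Fin d → ℤ)} {a : Fin d → ℤ}

theorem mem_cornerComponent_self (ha : a ∈ U) : a ∈ cornerComponent r U a :=
  ⟨ha, Relation.ReflTransGen.refl⟩

theorem cornerComponent_subset : cornerComponent r U a ⊆ U := by
  rintro b ⟨ha, hb⟩
  rcases Relation.ReflTransGen.cases_tail hb with rfl | ⟨c, -, hc⟩
  exacts [ha, hc.1]

theorem mem_cornerComponent_of_near {x y : Fin d → ℤ} (hx : x ∈ cornerComponent r U a)
    (hy : y ∈ U) (hxy : Near (6 * r - 1) x y) : y ∈ cornerComponent r U a :=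
  ⟨hx.1, hx.2.tail ⟨hy, hxy⟩⟩

theorem weaklyConnected_cornerComponent : WeaklyConnected r (cornerComponent r U a) := by
  intro ψ hψ
  have key : ∀ x ∈ cornerComponent r U a, ψ a = ψ x := by
    rintro x ⟨ha, hx⟩
    induction hx with
    | refl => rfl
    | tail hb hbc ih => exact ih.trans (hψ _ ⟨ha, hb⟩ _ ⟨ha, hb.tail hbc⟩ hbc.2)
  exact fun x hx y hy => (key x hx).symm.trans (key y hy)

theorem notMem_of_mem_cornerComponent {y x : Fin d → ℤ} (hy : y ∈ U)
    (hya : y ∉ cornerComponent r U a) (hx : x ∈ cornerComponent r U y) :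
    x ∉ cornerComponent r U a := by
  obtain ⟨-, hx⟩ := hx
  suffices h : x ∈ U ∧ x ∉ cornerComponent r U a from h.2
  induction hx with
  | refl => exact ⟨hy, hya⟩
  | tail hb hbc ih =>
    exact ⟨hbc.1, fun hc => ih.2 (mem_cornerComponent_of_near hc ih.1 hbc.2.symm)⟩

end Component

theorem zero_mem_gridCorners {d n r : ℕ} (hn : 2 * r ≤ n) : (0 : Fin d → ℤ) ∈ gridCorners d n r :=
  fun i => ⟨le_rfl, by rw [Pi.zero_apply]; omega, Or.inr (dvd_zero _)⟩

/-- Every component of the complement of a connected set touches that set, hence the complement of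
a single component is connected. -/
theorem weaklyConnected_compl_cornerComponent {d n r : ℕ} (hr : 0 < r)
    {C : Set (Fin d → ℤ)} {o : Fin d → ℤ} (hCV : C ⊆ gridCorners d n r) (ho : o ∈ C)
    (hC : WeaklyConnected r C) (a : Fin d → ℤ) :
    WeaklyConnected r (gridCorners d n r \ cornerComponent r (gridCorners d n r \ C) a) := by
  intro ψ hψ
  have hr' : (1 : ℤ) ≤ r := by exact_mod_cast hr
  have hCS : ∀ x ∈ C, x ∈ gridCorners d n r \ cornerComponent r (gridCorners d n r \ C) a :=
    fun x hx => ⟨hCV hx, fun h => (cornerComponent_subset h).2 hx⟩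
  have hψC : ∀ x ∈ C, ψ x = ψ o := fun x hx =>
    hC ψ (fun x hx y hy hxy => hψ x (hCS x hx) y (hCS y hy) hxy) x hx o ho
  have key : ∀ y ∈ gridCorners d n r \ cornerComponent r (gridCorners d n r \ C) a,
      ψ y = ψ o := by
    rintro y ⟨hyV, hyS⟩
    by_cases hyC : y ∈ C
    · exact hψC y hyC
    have hyU : y ∈ gridCorners d n r \ C := ⟨hyV, hyC⟩
    obtain ⟨z, hz, z', hz', hzS, hzS', hzz', -, -⟩ := exists_switch hr
      (· ∈ cornerComponent r (gridCorners d n r \ C) y) hyV (hCV ho)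
      (mem_cornerComponent_self hyU) (fun h => (cornerComponent_subset h).2 ho)
    have hnear : Near (6 * r - 1) z z' := hzz'.mono (by omega)
    have hzC' : z' ∈ C := by
      by_contra h
      exact hzS' (mem_cornerComponent_of_near hzS ⟨hz', h⟩ hnear)
    have hsub : ∀ x ∈ cornerComponent r (gridCorners d n r \ C) y,
        x ∈ gridCorners d n r \ cornerComponent r (gridCorners d n r \ C) a := fun x hx =>
      ⟨(cornerComponent_subset hx).1, notMem_of_mem_cornerComponent hyU hyS hx⟩
    calc ψ y = ψ z := weaklyConnected_cornerComponent ψ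
          (fun u hu v hv huv => hψ u (hsub u hu) v (hsub v hv) huv) y
          (mem_cornerComponent_self hyU) z hzS
      _ = ψ z' := hψ z (hsub z hzS) z' (hCS z' hzC') hnear
      _ = ψ o := hψC z' hzC'
  exact fun x hx y hy => (key x hx).trans (key y hy).symm

/-- A closed corner is found near each boundary point of a component, on the way to the cluster. -/
theorem exists_closed_near_innerBoundary {d n r : ℕ} (hr : 0 < r) {C F : Set (Fin d → ℤ)}
    (hF : ∀ z ∈ C, ∀ z' ∈ gridCorners d n r, z' ∉ C → Near r z z' → z' ∈ F) {a x : Fin d → ℤ}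
    (hx : x ∈ innerBoundary n r (cornerComponent r (gridCorners d n r \ C) a)) :
    ∃ z ∈ gridCorners d n r, z ∈ F ∧ Near (6 * r - 1) z x := by
  obtain ⟨hxS, y, hy, hyS, hxy⟩ := hx
  have hxU := cornerComponent_subset hxS
  have hyC : y ∈ C := by
    by_contra h
    exact hyS (mem_cornerComponent_of_near hxS ⟨hy, h⟩ hxy)
  obtain ⟨z, hz, z', hz', hzC, hzC', hzz', -, hI⟩ := exists_switch hr (· ∈ C) hy hxU.1 hyC hxU.2
  refine ⟨z', hz', hF z hzC z' hz' hzC' hzz', fun i => ?_⟩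
  have h1 : min (y i) (x i) ≤ z' i := hI.1 i
  have h2 : z' i ≤ max (y i) (x i) := hI.2 i
  have h3 := abs_le.1 (hxy i)
  rw [abs_le]
  omega

/-- `K` points of `F` in the grid, at distance more than `10 r` from each other and within
`30 K r` of `b`. -/
def HasSpread {d : ℕ} (n r K : ℕ) (F : Set (Fin d → ℤ)) (b : Fin d → ℤ) : Prop :=
  ∃ z : Fin K → (Fin d → ℤ), (∀ j, z j ∈ gridCorners d n r ∧ z j ∈ F ∧ Near (30 * K * r) (z j) b) ∧
    ∀ i j, i < j → ¬ Near (10 * r) (z i) (z j)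

/-- If the boundary were not contained in a ball of radius `30 K r`, connectedness at scale `7 r`
would give boundary points in `K` concentric annuli of width `7 r`, with closed corners nearby. -/
theorem innerBoundary_near {d n r K : ℕ} (hr : 0 < r) {C F : Set (Fin d → ℤ)} {o : Fin d → ℤ}
    (hCV : C ⊆ gridCorners d n r) (ho : o ∈ C) (hC : WeaklyConnected r C)
    (hF : ∀ z ∈ C, ∀ z' ∈ gridCorners d n r, z' ∉ C → Near r z z' → z' ∈ F) {a : Fin d → ℤ}
    (hspread : ∀ b ∈ gridCorners d n r, ¬ HasSpread n r K F b) {x₀ x₁ : Fin d → ℤ}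
    (hx₀ : x₀ ∈ innerBoundary n r (cornerComponent r (gridCorners d n r \ C) a))
    (hx₁ : x₁ ∈ innerBoundary n r (cornerComponent r (gridCorners d n r \ C) a)) :
    Near (30 * K * r) x₁ x₀ := by
  by_contra hfar
  have hr' : (1 : ℤ) ≤ r := by exact_mod_cast hr
  have hle : ∀ {i j : ℕ}, i ≤ j → (30 * i * r : ℤ) ≤ 30 * j * r := fun h => by gcongr
  have hann : ∀ j : Fin K, ∃ z ∈ gridCorners d n r, z ∈ F ∧ ∃ x, Near (6 * r - 1) z x ∧
      ¬ Near (30 * (j : ℕ) * r) x x₀ ∧ Near (30 * (j : ℕ) * r + 7 * r) x x₀ := by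
    intro j
    by_contra! h
    refine hfar ((forall_innerBoundary_of_propagates hr (fun x hx => (cornerComponent_subset hx).1)
      weaklyConnected_cornerComponent (weaklyConnected_compl_cornerComponent hr hCV ho hC a)
      (T := fun x => Near (30 * (j : ℕ) * r) x x₀) ?_ hx₀ (Near.refl (by positivity) _) x₁
      hx₁).mono (hle j.2.le))
    intro x hx x' hx' hxx' hTx
    by_contra hTx'
    obtain ⟨z, hz, hzF, hzx⟩ := exists_closed_near_innerBoundary hr hF hx'
    exact h z hz hzF x' hzx hTx' ((hxx'.symm.trans hTx).mono (by omega))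
  choose z hzV hzF x hzx hfarx hx using hann
  refine hspread x₀ (cornerComponent_subset hx₀.1).1 ⟨z, fun j => ⟨hzV j, hzF j, ?_⟩,
    fun i j hij hz => ?_⟩
  · refine ((hzx j).trans (hx j)).mono ?_
    have h1 : (30 * ((j : ℕ) + 1 : ℕ) * r : ℤ) ≤ 30 * K * r := hle j.2
    have h2 : (30 * ((j : ℕ) + 1 : ℕ) * r : ℤ) = 30 * (j : ℕ) * r + 30 * r := by push_cast; ring
    omega
  -- the annuli have inner radii `30 i r` and width `7 r`, and `7 + 2 * 6 + 10 ≤ 30`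
  · refine hfarx j (((hzx j).symm.trans (hz.symm.trans ((hzx i).trans (hx i)))).mono ?_)
    have h1 : (30 * ((i : ℕ) + 1 : ℕ) * r : ℤ) ≤ 30 * (j : ℕ) * r := hle hij
    have h2 : (30 * ((i : ℕ) + 1 : ℕ) * r : ℤ) = 30 * (i : ℕ) * r + 30 * r := by push_cast; ring
    omega

/-- In dimension at least two, the complement of a ball in a large grid is connected. Hence a set
whose boundary lies in the ball either contains or avoids all grid corners outside the ball. -/
theorem mem_of_notNear {d n r : ℕ} (hd : 2 ≤ d) (hr : 0 < r) {S : Set (Fin d → ℤ)}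
    {c : Fin d → ℤ} {ρ : ℤ} (hS : ∀ x ∈ innerBoundary n r S, Near ρ x c)
    (hn : 2 * ρ < (n : ℤ) - 2 * r) {u v : Fin d → ℤ} (hu : u ∈ gridCorners d n r)
    (hv : v ∈ gridCorners d n r) (huc : ¬ Near ρ u c) (hvc : ¬ Near ρ v c) (huS : u ∈ S) :
    v ∈ S := by
  have hr' : (1 : ℤ) ≤ r := by exact_mod_cast hr
  have step : ∀ i, ∀ u ∈ gridCorners d n r, ∀ v ∈ gridCorners d n r, u i = v i →
      ¬ |u i - c i| ≤ ρ → u ∈ S → v ∈ S := by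
    intro i u hu v hv huv hui huS
    by_contra hvS
    obtain ⟨z, hz, z', hz', hzS, hzS', hzz', hI, -⟩ := exists_switch hr (· ∈ S) hu hv huS hvS
    have h1 := hI.1 i
    have h2 := hI.2 i
    rw [Pi.inf_apply, ← huv, min_self] at h1
    rw [Pi.sup_apply, ← huv, max_self] at h2
    have h3 := hS z ⟨hzS, z', hz', hzS', hzz'.mono (by omega)⟩ i
    rw [le_antisymm h2 h1] at h3
    exact hui h3
  have hupd : ∀ w ∈ gridCorners d n r, ∀ i s, (∀ w' ∈ gridCorners d n r, w' i = s →
      Function.update w i s ∈ gridCorners d n r) := by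
    intro w hw i s w' hw' hs j
    by_cases hj : j = i
    · subst hj
      rw [Function.update_self, ← hs]
      exact hw' j
    · rw [Function.update_of_ne hj]
      exact hw j
  -- `u` is joined to `v` along paths that keep one coordinate fixed at a value missed by the ball
  obtain ⟨i, hi⟩ := not_forall.1 huc
  obtain ⟨k, hk⟩ := not_forall.1 hvc
  by_cases hik : i = k
  · subst hik
    have : Nontrivial (Fin d) := Fin.nontrivial_iff_two_le.2 hd
    obtain ⟨j, hj⟩ := exists_ne i
    -- the detour goes through a hyperplane `x j = s` that misses the ball
    obtain ⟨s, ⟨w, hw, hws⟩, hs⟩ : ∃ s, (∃ w ∈ gridCorners d n r, w j = s) ∧ ¬ |s - c j| ≤ ρ := by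
      have hn0 : (0 : ℤ) ≤ (n : ℤ) - 2 * r := (hu i).1.trans (hu i).2.1
      by_cases h0 : |0 - c j| ≤ ρ
      · refine ⟨(n : ℤ) - 2 * r, ⟨fun _ => (n : ℤ) - 2 * r, fun _ => ⟨hn0, le_rfl, Or.inl rfl⟩,
          rfl⟩, fun h => ?_⟩
        rw [abs_le] at h h0
        omega
      · exact ⟨0, ⟨fun _ => 0, fun _ => ⟨le_rfl, hn0, Or.inr (dvd_zero _)⟩, rfl⟩, h0⟩
    have hu' := hupd u hu j s w hw hws
    have hv' := hupd v hv j s w hw hws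
    refine step i _ hv' v hv (Function.update_of_ne hj.symm _ _)
      (by rwa [Function.update_of_ne hj.symm]) ?_
    refine step j _ hu' _ hv' (by simp) (by simpa using hs) ?_
    exact step i u hu _ hu' (Function.update_of_ne hj.symm _ _).symm hi huS
  · have hw := hupd v hv i (u i) u hu rfl
    refine step k _ hw v hv (Function.update_of_ne (Ne.symm hik) _ _)
      (by rwa [Function.update_of_ne (Ne.symm hik)]) ?_
    exact step i u hu _ hw (by simp) hi huS

/-- `c` is one of the `2 ^ d` extreme points of the grid: every coordinate is minimal or maximal. -/
def IsExtreme {d : ℕ} (n r : ℕ) (c : Fin d → ℤ) : Prop := ∀ i, c i = 0 ∨ c i = (n : ℤ) - 2 * r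

/-- Components of the complement of `C` have diameter of order `K r`, if `F`, which contains all
points of the complement adjacent to `C`, has no `K` spread-out points in a ball of radius
`30 K r` and no points near the origin. -/
theorem cornerComponent_near {d n r K : ℕ} (hd : 2 ≤ d) (hr : 0 < r)
    {C F : Set (Fin d → ℤ)} (hCV : C ⊆ gridCorners d n r) (ho : (0 : Fin d → ℤ) ∈ C)
    (hC : WeaklyConnected r C)
    (hF : ∀ z ∈ C, ∀ z' ∈ gridCorners d n r, z' ∉ C → Near r z z' → z' ∈ F)
    (hspread : ∀ b ∈ gridCorners d n r, ¬ HasSpread n r K F b)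
    (hopen : ∀ b ∈ gridCorners d n r, Near ((60 * K + 1) * r) b 0 → b ∉ F) {a b : Fin d → ℤ}
    (ha : a ∈ gridCorners d n r \ C) (hb : b ∈ cornerComponent r (gridCorners d n r \ C) a) :
    Near ((60 * K + 1) * r) b a := by
  have hr' : (1 : ℤ) ≤ r := by exact_mod_cast hr
  have hR : ((60 * K + 1) * r : ℤ) = 2 * (30 * K * r) + r := by ring
  have hR0 : (0 : ℤ) ≤ 30 * K * r := by positivity
  rw [hR] at hopen ⊢
  have hbV := (cornerComponent_subset hb).1
  by_cases hsmall : (n : ℤ) - 2 * r ≤ 2 * (30 * K * r) + r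
  -- in this case the whole grid is smaller than the claimed bound
  · intro i
    have h1 := hbV i
    have h2 := ha.1 i
    rw [abs_le]
    omega
  have haS := mem_cornerComponent_self (r := r) ha
  obtain ⟨x₀, -, z', hz', hx₀S, hzS', hzz', -, -⟩ := exists_switch hr
    (· ∈ cornerComponent r (gridCorners d n r \ C) a) ha.1 (hCV ho) haS
    (fun h => (cornerComponent_subset h).2 ho)
  have hx₀ : x₀ ∈ innerBoundary n r (cornerComponent r (gridCorners d n r \ C) a) :=
    ⟨hx₀S, z', hz', hzS', hzz'.mono (by omega)⟩
  have hbd := fun x₁ hx₁ =>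
    innerBoundary_near (x₁ := x₁) hr hCV ho hC hF hspread hx₀ hx₁
  by_cases hin : ∀ u ∈ cornerComponent r (gridCorners d n r \ C) a, Near (30 * K * r) u x₀
  · exact ((hin b hb).trans (hin a haS).symm).mono (by omega)
  -- otherwise the cluster is confined to the ball, although it contains all corners near `0`
  exfalso
  push Not at hin
  obtain ⟨u, huS, hux⟩ := hin
  have huV := (cornerComponent_subset huS).1
  have hout : ∀ v ∈ gridCorners d n r, v ∈ C → Near (30 * K * r) v x₀ := by
    intro v hv hvC
    by_contra hvx
    exact (cornerComponent_subset
      (mem_of_notNear hd hr hbd (by omega) huV hv hux hvx huS)).2 hvC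
  let i₀ : Fin d := ⟨0, by omega⟩
  let w : Fin d → ℤ := Function.update 0 i₀ (2 * (30 * K * r) + r)
  have hw0 : ∀ i, 0 ≤ w i ∧ w i ≤ 2 * (30 * K * r) + r := by
    intro i
    by_cases hi : i = i₀
    · subst hi
      simp only [w, Function.update_self]
      omega
    · simp only [w, Function.update_of_ne hi, Pi.zero_apply]
      omega
  have hw : w ∈ gridCorners d n r := by
    intro i
    have h0 := hw0 i
    refine ⟨h0.1, by omega, Or.inr ?_⟩
    by_cases hi : i = i₀
    · subst hi
      simp only [w, Function.update_self]
      exact ⟨60 * K + 1, by ring⟩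
    · simp only [w, Function.update_of_ne hi, Pi.zero_apply]
      exact dvd_zero _
  have hwC : w ∉ C := by
    intro h
    have h1 := abs_le.1 (hout w hw h i₀)
    have h2 := abs_le.1 (hout 0 (hCV ho) ho i₀)
    have h3 : w i₀ = 2 * (30 * K * r) + r := Function.update_self _ _ _
    rw [h3] at h1
    rw [Pi.zero_apply] at h2
    omega
  obtain ⟨z, hz, y, hy, hzC, hyC, hzy, -, hI⟩ := exists_switch hr (· ∈ C) (hCV ho) hw ho hwC
  refine hopen y hy (fun i => ?_) (hF z hzC y hy hyC hzy)
  have h1 : min 0 (w i) ≤ y i := hI.1 i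
  have h2 : y i ≤ max 0 (w i) := hI.2 i
  have h3 := hw0 i
  rw [Pi.zero_apply, abs_le]
  omega

/-- If components have bounded size and no closed corners lie near `c`, then the grid corners near
`c` belong to the cluster. -/
theorem mem_of_near_open_corner {d n r : ℕ} (hr : 0 < r) {C F : Set (Fin d → ℤ)}
    {o c : Fin d → ℤ} {ρ τ : ℤ} (hCV : C ⊆ gridCorners d n r) (ho : o ∈ C)
    (hF : ∀ z ∈ C, ∀ z' ∈ gridCorners d n r, z' ∉ C → Near r z z' → z' ∈ F)
    (hρ : ∀ a ∈ gridCorners d n r \ C, ∀ b ∈ cornerComponent r (gridCorners d n r \ C) a,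
      Near ρ b a)
    (hopen : ∀ b ∈ gridCorners d n r, Near (ρ + τ) b c → b ∉ F) {a : Fin d → ℤ}
    (ha : a ∈ gridCorners d n r) (hac : Near τ a c) : a ∈ C := by
  have hr' : (1 : ℤ) ≤ r := by exact_mod_cast hr
  by_contra haC
  have haU : a ∈ gridCorners d n r \ C := ⟨ha, haC⟩
  obtain ⟨z, hz, z', hz', hzS, hzS', hzz', -, -⟩ := exists_switch hr
    (· ∈ cornerComponent r (gridCorners d n r \ C) a) ha (hCV ho) (mem_cornerComponent_self haU)
    (fun h => (cornerComponent_subset h).2 ho)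
  have hzC' : z' ∈ C := by
    by_contra h
    exact hzS' (mem_cornerComponent_of_near hzS ⟨hz', h⟩ (hzz'.mono (by omega)))
  exact hopen z hz ((hρ a haU z hzS).trans hac)
    (hF z' hzC' z hz (cornerComponent_subset hzS).2 hzz'.symm)

/-! ### The deterministic part of the theorem -/

/-- The smallest corners of the grid boxes in the cluster of `Λ_{2r}`. -/
def clusterCorners {d q n : ℕ} (r : ℕ) (σ : Labeling d q n) : Set (Fin d → ℤ) :=
  {a | a ∈ gridCorners d n r ∧ box a (2 * r) ∈ cluster r σ}

/-- The smallest corners, on or off the grid, of the `2r`-boxes that are not open. -/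
def closedCorners {d q n : ℕ} (r : ℕ) (σ : Labeling d q n) : Set (Fin d → ℤ) :=
  {a | ¬ IsOpenBox r σ (box a (2 * r))}

theorem zero_mem_clusterCorners {d q n r : ℕ} (hr : 0 < r) (hn : 2 * r ≤ n) {σ : Labeling d q n}
    (h : (0 : Fin d → ℤ) ∉ closedCorners r σ) : (0 : Fin d → ℤ) ∈ clusterCorners r σ := by
  have h0 := zero_mem_gridCorners (d := d) hn
  exact ⟨h0, ⟨(box_mem_gridBoxes hr).2 h0, not_not.1 h⟩, Relation.ReflTransGen.refl⟩

theorem weaklyConnected_clusterCorners {d q n r : ℕ} (hr : 0 < r) (σ : Labeling d q n) :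
    WeaklyConnected r (clusterCorners r σ) := by
  intro ψ hψ
  have key : ∀ x ∈ clusterCorners r σ, ψ 0 = ψ x := by
    rintro x ⟨-, h0, hx⟩
    suffices h : ∀ B, Relation.ReflTransGen (fun a b => b ∈ {B' | B' ∈ gridBoxes d n r ∧
        IsOpenBox r σ B'} ∧ StrongNeighbor r a b) (Lam d (2 * r)) B →
        ∀ x, B = box x (2 * r) → ψ 0 = ψ x from h _ hx x rfl
    intro B hB
    induction hB with
    | refl =>
      intro x hx
      exact congrArg ψ (box_injective (s := 2 * r) (by omega) hx)
    | @tail B B' hB hBB' ih =>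
      rintro y rfl
      have hBmem : B ∈ cluster r σ := ⟨h0, hB⟩
      have hBg : B ∈ gridBoxes d n r := by
        rcases Relation.ReflTransGen.cases_tail hB with h | ⟨_, -, h⟩
        · rw [h]; exact h0.1
        · exact h.1.1
      obtain ⟨x, hx, rfl⟩ := (mem_gridBoxes hr).1 hBg
      exact (ih x rfl).trans (hψ x ⟨hx, hBmem⟩ y ⟨(box_mem_gridBoxes hr).1 hBB'.1.1, h0,
        hB.tail hBB'⟩ ((weakNeighbor_box hr).1 (hBB'.2.weakNeighbor hr)))
  exact fun x hx y hy => (key x hx).symm.trans (key y hy)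

theorem mem_closedCorners_of_near_clusterCorners {d q n r : ℕ} (hr : 0 < r) {σ : Labeling d q n}
    {z z' : Fin d → ℤ} (hz : z ∈ clusterCorners r σ) (hz' : z' ∈ gridCorners d n r)
    (hzC' : z' ∉ clusterCorners r σ) (h : Near r z z') : z' ∈ closedCorners r σ := fun hopen =>
  hzC' ⟨hz', hz.2.1, hz.2.2.tail ⟨⟨(box_mem_gridBoxes hr).2 hz', hopen⟩, strongNeighbor_box h⟩⟩

theorem exists_of_mem_weakComponent {d q n r : ℕ} (hr : 0 < r) {σ : Labeling d q n}
    {a : Fin d → ℤ} {B : Finset (Fin d → ℤ)}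
    (hB : B ∈ weakComponent r (gridBoxes d n r \ cluster r σ) (box a (2 * r))) :
    ∃ b ∈ cornerComponent r (gridCorners d n r \ clusterCorners r σ) a, B = box b (2 * r) := by
  have hmem : ∀ b : Fin d → ℤ, box b (2 * r) ∈ gridBoxes d n r \ cluster r σ →
      b ∈ gridCorners d n r \ clusterCorners r σ := fun b hb =>
    ⟨(box_mem_gridBoxes hr).1 hb.1, fun h => hb.2 h.2⟩
  obtain ⟨ha, hB⟩ := hB
  induction hB with
  | refl => exact ⟨a, mem_cornerComponent_self (hmem a ha), rfl⟩
  | tail _ hBB' ih =>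
    obtain ⟨b, hb, rfl⟩ := ih
    obtain ⟨b', hb', rfl⟩ := (mem_gridBoxes hr).1 hBB'.1.1
    exact ⟨b', mem_cornerComponent_of_near hb (hmem b' hBB'.1) ((weakNeighbor_box hr).1 hBB'.2),
      rfl⟩

theorem diam_weakComponent_le {d q n r K : ℕ} (hd : 2 ≤ d) (hr : 0 < r) (hn : 2 * r ≤ n)
    {σ : Labeling d q n}
    (hspread : ∀ b ∈ gridCorners d n r, ¬ HasSpread n r K (closedCorners r σ) b)
    (hopen : ∀ b ∈ gridCorners d n r, Near ((60 * K + 1) * r) b 0 → b ∉ closedCorners r σ)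
    {B : Finset (Fin d → ℤ)} (hB : B ∈ gridBoxes d n r \ cluster r σ) :
    Metric.diam (vertexSet (weakComponent r (gridBoxes d n r \ cluster r σ) B)) ≤
      (120 * K + 4 : ℝ) * r := by
  obtain ⟨a, ha, rfl⟩ := (mem_gridBoxes hr).1 hB.1
  have h0 := zero_mem_clusterCorners hr hn (hopen 0 (zero_mem_gridCorners hn)
    (Near.refl (by positivity) _))
  have hbound : ∀ v ∈ vertexSet (weakComponent r (gridBoxes d n r \ cluster r σ) (box a (2 * r))),
      ∀ i, a i - (60 * K + 1) * r ≤ v i ∧ v i ≤ a i + (60 * K + 1) * r + 2 * r := by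
    rintro v ⟨B', hB', hv⟩ i
    obtain ⟨b, hb, rfl⟩ := exists_of_mem_weakComponent hr hB'
    have h1 := abs_le.1 (cornerComponent_near hd hr (fun x hx => hx.1) h0
      (weaklyConnected_clusterCorners hr σ)
      (fun z hz z' hz' hzC' h => mem_closedCorners_of_near_clusterCorners hr hz hz' hzC' h)
      hspread hopen ⟨ha, fun h => hB.2 h.2⟩ hb i)
    have h2 := mem_box.1 hv i
    push_cast at h2
    constructor <;> linarith
  refine Metric.diam_le_of_forall_dist_le (by positivity) fun u hu v hv => ?_
  rw [dist_pi_le_iff (by positivity)]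
  intro i
  have h1 := hbound u hu i
  have h2 := hbound v hv i
  rw [Int.dist_eq]
  have : |u i - v i| ≤ (120 * K + 4) * r := by
    rw [abs_le]
    constructor <;> linarith
  exact_mod_cast this

theorem corner_subset_vertexSet_cluster {d q n r K T : ℕ} (hd : 2 ≤ d) (hr : 0 < r)
    (hn : 2 * r ≤ n) {κ' : ℝ} (hκ' : κ' ≤ T) {σ : Labeling d q n}
    (hspread : ∀ b ∈ gridCorners d n r, ¬ HasSpread n r K (closedCorners r σ) b)
    (hopen : ∀ c, IsExtreme n r c → ∀ b ∈ gridCorners d n r,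
      Near ((60 * K + 1 + T) * r) b c → b ∉ closedCorners r σ) :
    corner d n r κ' ⊆ vertexSet (cluster r σ) := by
  have hr' : (1 : ℤ) ≤ r := by exact_mod_cast hr
  have hTr : (0 : ℤ) ≤ T * r := by positivity
  have hopen₀ : ∀ b ∈ gridCorners d n r, Near ((60 * K + 1) * r) b 0 → b ∉ closedCorners r σ :=
    fun b hb h => hopen 0 (fun _ => Or.inl rfl) b hb (h.mono (by linarith))
  have h0 := zero_mem_clusterCorners hr hn (hopen₀ 0 (zero_mem_gridCorners hn)
    (Near.refl (by positivity) _))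
  have hF := fun z hz z' hz' hzC' h =>
    mem_closedCorners_of_near_clusterCorners (σ := σ) (z := z) (z' := z') hr hz hz' hzC' h
  rintro v ⟨hvΛ, hv⟩
  have hv' : ∀ i, v i ≤ T * r ∨ (n : ℤ) - T * r ≤ v i := by
    intro i
    have h1 : κ' * r ≤ T * r := by gcongr
    have h2 := hv i
    rw [Set.mem_Ioo, not_and_or, not_lt, not_lt] at h2
    rcases h2 with h2 | h2
    · left; exact_mod_cast h2.trans h1
    · right
      have : (n : ℝ) - T * r ≤ v i := by linarith
      exact_mod_cast this
  -- `a` is the corner of a grid box containing `v`, and `c` an extreme point near `v`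
  let a : Fin d → ℤ := fun i => min (r * (v i / r)) ((n : ℤ) - 2 * r)
  have hn0 : (0 : ℤ) ≤ (n : ℤ) - 2 * r := by omega
  have hdiv : ∀ i, 0 ≤ r * (v i / r) ∧ r * (v i / r) ≤ v i ∧ v i < r * (v i / r) + r := by
    intro i
    have h1 := Int.mul_ediv_add_emod (v i) r
    have h2 := Int.emod_nonneg (v i) (b := r) (by omega)
    have h3 := Int.emod_lt_of_pos (v i) (b := r) (by omega)
    have h4 := Int.ediv_nonneg (mem_Lam.1 hvΛ i).1 (b := r) (by omega)
    have h5 : 0 ≤ (r : ℤ) * (v i / r) := by positivity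
    omega
  have ha : a ∈ gridCorners d n r := by
    intro i
    have h := hdiv i
    simp only [a]
    rcases min_choice ((r : ℤ) * (v i / r)) ((n : ℤ) - 2 * r) with h' | h'
    · refine ⟨by omega, by omega, Or.inr ?_⟩
      rw [h']
      exact dvd_mul_right _ _
    · exact ⟨by omega, by omega, Or.inl h'⟩
  let c : Fin d → ℤ := fun i => if v i ≤ T * r then 0 else (n : ℤ) - 2 * r
  have hac : Near (T * r) a c := by
    intro i
    have h := hdiv i
    have h' := hv' i
    have h'' := (mem_Lam.1 hvΛ i).2
    simp only [a, c]
    rw [abs_le]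
    split_ifs <;> omega
  have haC : a ∈ clusterCorners r σ := by
    refine mem_of_near_open_corner hr (fun x hx => hx.1) h0 hF
      (ρ := (60 * K + 1) * r) (fun a ha b hb => cornerComponent_near hd hr (fun x hx => hx.1) h0
      (weaklyConnected_clusterCorners hr σ) hF hspread hopen₀ ha hb) ?_ ha hac
    refine fun b hb h => hopen c (fun i => ?_) b hb (h.mono (by linarith))
    simp only [c]
    split_ifs <;> simp
  refine ⟨_, haC.2, mem_box.2 fun i => ?_⟩
  have h := hdiv i
  have h'' := (mem_Lam.1 hvΛ i).2
  push_cast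
  simp only [a]
  omega

/-! ### Counting labelings with prescribed coincidences -/

theorem vadd_box {d : ℕ} (t a : Fin d → ℤ) (s : ℕ) : t +ᵥ box a s = box (t + a) s := by
  ext x
  rw [Finset.mem_vadd_finset]
  constructor
  · rintro ⟨y, hy, rfl⟩
    rw [mem_box] at hy ⊢
    intro i
    have := hy i
    simp only [vadd_eq_add, Pi.add_apply]
    omega
  · intro hx
    refine ⟨x - t, ?_, by simp⟩
    rw [mem_box] at hx ⊢
    intro i
    have := hx i
    simp only [Pi.sub_apply, Pi.add_apply] at this ⊢
    omega

/-- The labels on the `s`-box with smallest corner `a` are repeated on its translate by `t`. -/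
def Matches {d q n : ℕ} (s : ℕ) (σ : Labeling d q n) (a t : Fin d → ℤ) : Prop :=
  ∀ x y : ↥(Lam d n), x.1 ∈ box a s → y.1 = t + x.1 → σ x = σ y

/-- The `s`-boxes at `a j` are disjoint, their translates by `t j ≠ 0` stay in `Λ_n`, and no
translate meets an earlier box. The labels on the boxes of such a family are determined by the
other labels as soon as all the boxes match their translates. -/
structure IsTriangular {d k : ℕ} (n s : ℕ) (a t : Fin k → (Fin d → ℤ)) : Prop where
  ne_zero : ∀ j, t j ≠ 0
  subset : ∀ j, box (a j) s ⊆ Lam d n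
  translate_subset : ∀ j, box (t j + a j) s ⊆ Lam d n
  disjoint : ∀ i j, i < j → Disjoint (box (a i) s) (box (a j) s)
  translate_disjoint : ∀ i j, i < j → Disjoint (box (t j + a j) s) (box (a i) s)

theorem add_mem_box {d s : ℕ} {a t x : Fin d → ℤ} (hx : x ∈ box a s) : t + x ∈ box (t + a) s := by
  rw [mem_box] at hx ⊢
  intro i
  have := hx i
  simp only [Pi.add_apply]
  omega

/-- The labels on a box are determined by those outside, if they match a translate: following the
translation, every point eventually leaves the box. -/
theorem eqOn_box_of_matches {d q n s : ℕ} {σ σ' : Labeling d q n} {a t : Fin d → ℤ}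
    (ht : t ≠ 0) (ha' : box (t + a) s ⊆ Lam d n)
    (hσ : Matches s σ a t) (hσ' : Matches s σ' a t)
    (hout : ∀ y : ↥(Lam d n), y.1 ∈ box (t + a) s → y.1 ∉ box a s → σ y = σ' y)
    (x : ↥(Lam d n)) (hx : x.1 ∈ box a s) : σ x = σ' x := by
  obtain ⟨c, hc⟩ := Function.ne_iff.1 ht
  rw [Pi.zero_apply] at hc
  -- the distance to the side of `Λ_n` towards which `t` moves the coordinate `c` decreases
  induction hm : (if 0 < t c then (n : ℤ) - x.1 c else x.1 c).toNat using Nat.strong_induction_on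
    generalizing x with
  | _ m ih =>
    have hy : t + x.1 ∈ box (t + a) s := add_mem_box hx
    let y : ↥(Lam d n) := ⟨t + x.1, ha' hy⟩
    rw [hσ x y hx rfl, hσ' x y hx rfl]
    by_cases hya : y.1 ∈ box a s
    · refine ih _ ?_ y hya rfl
      have h1 := mem_Lam.1 x.2 c
      have h2 := mem_Lam.1 y.2 c
      have h3 : y.1 c = t c + x.1 c := rfl
      rw [h3] at h2 ⊢
      split_ifs at hm ⊢ <;> omega
    · exact hout y hy hya

/-- A labeling for which a triangular family matches is determined by its values off the boxes of
the family: labels on the last box come from outside the family, and so on backwards. -/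
theorem eq_of_matches {d q n s k : ℕ} {a t : Fin k → (Fin d → ℤ)} (h : IsTriangular n s a t)
    {σ σ' : Labeling d q n} (hσ : ∀ j, Matches s σ (a j) (t j))
    (hσ' : ∀ j, Matches s σ' (a j) (t j))
    (hout : ∀ x : ↥(Lam d n), (∀ j, x.1 ∉ box (a j) s) → σ x = σ' x) : σ = σ' := by
  have key : ∀ j, ∀ x : ↥(Lam d n), x.1 ∈ box (a j) s → σ x = σ' x := by
    intro j
    induction j using WellFoundedGT.induction with
    | ind j ih =>
      refine eqOn_box_of_matches (h.ne_zero j) (h.translate_subset j) (hσ j) (hσ' j) ?_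
      intro y hy hyj
      by_cases hyU : ∀ i, y.1 ∉ box (a i) s
      · exact hout y hyU
      push Not at hyU
      obtain ⟨i, hi⟩ := hyU
      rcases lt_trichotomy i j with hij | rfl | hij
      · exact absurd hi (Finset.disjoint_left.1 (h.translate_disjoint i j hij) hy)
      · exact absurd hi hyj
      · exact ih i hij y hi
  funext x
  by_cases hx : ∀ j, x.1 ∉ box (a j) s
  · exact hout x hx
  · push Not at hx
    exact key _ x hx.choose_spec

theorem ncard_matches_mul_le {d q n s k : ℕ} {a t : Fin k → (Fin d → ℤ)}
    (h : IsTriangular n s a t) :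
    {σ : Labeling d q n | ∀ j, Matches s σ (a j) (t j)}.ncard * q ^ (k * s ^ d) ≤ q ^ n ^ d := by
  classical
  let U : Finset (Fin d → ℤ) := Finset.univ.biUnion fun j => box (a j) s
  have hU : U.card = k * s ^ d := by
    rw [Finset.card_biUnion]
    · simp [card_box]
    · intro i _ j _ hij
      rcases lt_or_gt_of_ne hij with h' | h'
      exacts [h.disjoint i j h', (h.disjoint j i h').symm]
  have hUsub : U ⊆ Lam d n := Finset.biUnion_subset.2 fun j _ => h.subset j
  have hcard : (Lam d n \ U).card + k * s ^ d = n ^ d := by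
    rw [← hU, Finset.card_sdiff_add_card_eq_card hUsub, Lam, card_box]
  let Φ : Labeling d q n → (↥(Lam d n \ U) → Fin q) := fun σ x =>
    σ ⟨x.1, (Finset.mem_sdiff.1 x.2).1⟩
  have hinj : Set.InjOn Φ {σ | ∀ j, Matches s σ (a j) (t j)} := by
    intro σ hσ σ' hσ' heq
    refine eq_of_matches h hσ hσ' fun x hx => ?_
    have hxU : x.1 ∈ Lam d n \ U := by
      refine Finset.mem_sdiff.2 ⟨x.2, fun hxU => ?_⟩
      obtain ⟨j, -, hj⟩ := Finset.mem_biUnion.1 hxU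
      exact hx j hj
    exact congrFun heq ⟨x.1, hxU⟩
  have hle := Set.ncard_le_ncard_of_injOn (t := Set.univ) Φ (fun _ _ => Set.mem_univ _) hinj
  rw [Set.ncard_univ, Nat.card_fun, Nat.card_eq_fintype_card, Nat.card_eq_fintype_card,
    Fintype.card_fin, Fintype.card_coe] at hle
  calc _ ≤ q ^ (Lam d n \ U).card * q ^ (k * s ^ d) := by gcongr
    _ = q ^ n ^ d := by rw [← pow_add, hcard]

/-! ### The law of the labels -/

instance isProbabilityMeasure_labelLaw {d q n : ℕ} [NeZero q] :
    MeasureTheory.IsProbabilityMeasure (labelLaw d q n) := by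
  have : MeasureTheory.IsProbabilityMeasure
      (ProbabilityTheory.uniformOn (Set.univ : Set (Fin q))) :=
    ProbabilityTheory.isProbabilityMeasure_uniformOn Set.finite_univ Set.univ_nonempty
  unfold labelLaw
  infer_instance

theorem labelLaw_real {d q n : ℕ} [NeZero q] (s : Set (Labeling d q n)) :
    (labelLaw d q n).real s = s.ncard / (q : ℝ) ^ n ^ d := by
  classical
  have : MeasureTheory.IsProbabilityMeasure
      (ProbabilityTheory.uniformOn (Set.univ : Set (Fin q))) :=
    ProbabilityTheory.isProbabilityMeasure_uniformOn Set.finite_univ Set.univ_nonempty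
  have hsing : ∀ σ : Labeling d q n, (labelLaw d q n).real {σ} = ((q : ℝ) ^ n ^ d)⁻¹ := by
    intro σ
    have h1 : ∀ x : Fin q, ProbabilityTheory.uniformOn (Set.univ : Set (Fin q)) {x} =
        (q : ENNReal)⁻¹ := by
      intro x
      rw [ProbabilityTheory.uniformOn_univ]
      simp
    rw [MeasureTheory.measureReal_def, labelLaw, MeasureTheory.Measure.pi_singleton]
    simp only [h1, Finset.prod_const, Finset.card_univ, Fintype.card_coe]
    rw [Lam, card_box]
    simp
  have hfin := s.toFinite
  rw [Set.ncard_eq_toFinset_card s hfin]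
  conv_lhs => rw [← hfin.coe_toFinset]
  rw [← MeasureTheory.sum_measureReal_singleton]
  simp [hsing, div_eq_mul_inv]

theorem labelLaw_real_matches_le {d q n s k : ℕ} [NeZero q] {a t : Fin k → (Fin d → ℤ)}
    (h : IsTriangular n s a t) :
    (labelLaw d q n).real {σ | ∀ j, Matches s σ (a j) (t j)} ≤ (((q : ℝ) ^ s ^ d)⁻¹) ^ k := by
  have hq : (0 : ℝ) < q := by exact_mod_cast Nat.pos_of_ne_zero (NeZero.ne q)
  rw [labelLaw_real, div_le_iff₀ (by positivity), inv_pow, ← pow_mul, mul_comm (s ^ d) k,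
    ← div_eq_inv_mul, le_div_iff₀ (by positivity)]
  exact_mod_cast ncard_matches_mul_le (q := q) h

/-- Some triangular family of `k` boxes, with corners at distance at most `ℓ` from `b`, consists of
boxes that match their translates. -/
def HasMatches {d q n : ℕ} (s k ℓ : ℕ) (b : Fin d → ℤ) (σ : Labeling d q n) : Prop :=
  ∃ a t : Fin k → (Fin d → ℤ), IsTriangular n s a t ∧ (∀ j, Near ℓ (a j) b) ∧
    ∀ j, Matches s σ (a j) (t j)

/-- Union bound over the corners and the translations of a triangular family of `k` boxes. -/
theorem labelLaw_real_hasMatches_le {d q n s : ℕ} [NeZero q] (hs : 0 < s) (k ℓ : ℕ)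
    (b : Fin d → ℤ) :
    (labelLaw d q n).real {σ | HasMatches s k ℓ b σ} ≤
      (((2 * ℓ + 1 : ℝ) * (2 * n + 1)) ^ d / (q : ℝ) ^ s ^ d) ^ k := by
  classical
  let A : Finset (Fin k → (Fin d → ℤ)) :=
    Fintype.piFinset fun _ => Fintype.piFinset fun i => Finset.Icc (b i - ℓ) (b i + ℓ)
  let D : Finset (Fin k → (Fin d → ℤ)) :=
    Fintype.piFinset fun _ => Fintype.piFinset fun _ => Finset.Icc (-n : ℤ) n
  have hA : (A.card : ℝ) = ((2 * ℓ + 1 : ℝ) ^ d) ^ k := by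
    have : ∀ x : ℤ, (x + ℓ + 1 - (x - ℓ)).toNat = 2 * ℓ + 1 := by omega
    simp [A, Fintype.card_piFinset, this]
  have hD : (D.card : ℝ) = ((2 * n + 1 : ℝ) ^ d) ^ k := by
    have : ((n : ℤ) + 1 - (-n)).toNat = 2 * n + 1 := by omega
    simp only [D, Fintype.card_piFinset, Finset.prod_const, Finset.card_univ, Fintype.card_fin,
      Int.card_Icc, this]
    push_cast
    rfl
  have hsub : {σ : Labeling d q n | HasMatches s k ℓ b σ} ⊆ ⋃ p ∈ A ×ˢ D,
      {σ | IsTriangular n s p.1 p.2 ∧ ∀ j, Matches s σ (p.1 j) (p.2 j)} := by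
    rintro σ ⟨a, t, htri, hnear, hmatch⟩
    refine Set.mem_biUnion (x := (a, t)) (Finset.mem_product.2 ⟨?_, ?_⟩) ⟨htri, hmatch⟩
    · refine Fintype.mem_piFinset.2 fun j => Fintype.mem_piFinset.2 fun i => ?_
      have := abs_le.1 (hnear j i)
      exact Finset.mem_Icc.2 ⟨by dsimp only; omega, by dsimp only; omega⟩
    · refine Fintype.mem_piFinset.2 fun j => Fintype.mem_piFinset.2 fun i => ?_
      have h1 := (box_subset_Lam hs).1 (htri.subset j) i
      have h2 := (box_subset_Lam hs).1 (htri.translate_subset j) i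
      rw [Pi.add_apply] at h2
      exact Finset.mem_Icc.2 ⟨by dsimp only; omega, by dsimp only; omega⟩
  have hone : ∀ p ∈ A ×ˢ D, (labelLaw d q n).real
      {σ | IsTriangular n s p.1 p.2 ∧ ∀ j, Matches s σ (p.1 j) (p.2 j)} ≤
      (((q : ℝ) ^ s ^ d)⁻¹) ^ k := by
    intro p _
    by_cases hp : IsTriangular n s p.1 p.2
    · simpa only [hp, true_and] using labelLaw_real_matches_le hp
    · simp only [hp, false_and, Set.ofPred_false, MeasureTheory.measureReal_empty]
      positivity
  calc _ ≤ (labelLaw d q n).real (⋃ p ∈ A ×ˢ D,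
        {σ | IsTriangular n s p.1 p.2 ∧ ∀ j, Matches s σ (p.1 j) (p.2 j)}) :=
        MeasureTheory.measureReal_mono hsub (MeasureTheory.measure_ne_top _ _)
    _ ≤ ∑ p ∈ A ×ˢ D, (labelLaw d q n).real
        {σ | IsTriangular n s p.1 p.2 ∧ ∀ j, Matches s σ (p.1 j) (p.2 j)} :=
        MeasureTheory.measureReal_biUnion_finset_le _ _
    _ ≤ ∑ p ∈ A ×ˢ D, (((q : ℝ) ^ s ^ d)⁻¹) ^ k := Finset.sum_le_sum hone
    _ = _ := by
        rw [Finset.sum_const, Finset.card_product, nsmul_eq_mul]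
        push_cast
        rw [hA, hD, div_eq_mul_inv, mul_pow, mul_pow, mul_pow]

/-! ### Closed boxes contain matches -/

theorem exists_matches_of_mem_closedCorners {d q n r : ℕ} {σ : Labeling d q n} {z : Fin d → ℤ}
    (hr : 1 < r) (hz : z ∈ closedCorners r σ) :
    ∃ a t : Fin d → ℤ, box a (r - 1) ⊆ Lam d n ∧ (∀ i, z i ≤ a i ∧ a i ≤ z i + r + 1) ∧ t ≠ 0 ∧
      box (t + a) (r - 1) ⊆ Lam d n ∧ Matches (r - 1) σ a t := by
  unfold closedCorners IsOpenBox IsUnique at hz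
  rw [Set.mem_ofPred_eq] at hz
  push Not at hz
  obtain ⟨_, ⟨⟨a, rfl⟩, haΛ⟩, haz, t, ht, htΛ, hmatch⟩ := hz
  refine ⟨a, t, haΛ, fun i => ?_, ?_, by rwa [← vadd_box], fun x y hx hy => hmatch x y hx hy⟩
  · have hs : 0 < r - 1 := by omega
    have h1 := mem_box.1 (haz (left_mem_box a hs)) i
    have h2 : (fun i => a i + ((r - 1 : ℕ) : ℤ) - 1) ∈ box a (r - 1) :=
      mem_box.2 fun i => ⟨by omega, by omega⟩
    have h3 := (mem_box.1 (haz h2) i).2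
    push_cast at h1 h3
    omega
  · rintro rfl
    exact ht (zero_vadd _ _)

theorem hasMatches_of_mem_closedCorners {d q n r ℓ : ℕ} {σ : Labeling d q n} {z c : Fin d → ℤ}
    (hr : 1 < r) (hz : z ∈ closedCorners r σ) (hzc : Near ℓ z c) :
    HasMatches (r - 1) 1 (ℓ + 2 * r) c σ := by
  obtain ⟨a, t, ha, haz, ht, hta, hmatch⟩ := exists_matches_of_mem_closedCorners hr hz
  refine ⟨fun _ => a, fun _ => t, ⟨fun _ => ht, fun _ => ha, fun _ => hta, ?_, ?_⟩, fun _ i => ?_,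
    fun _ => hmatch⟩
  · exact fun i j hij => absurd hij (by omega)
  · exact fun i j hij => absurd hij (by omega)
  · have h1 := abs_le.1 (hzc i)
    have h2 := haz i
    rw [abs_le]
    push_cast
    omega

/-- Among `2 k` closed corners far from each other, each translate of a repeated box meets at most
one of the other boxes. Hence at least `k` of the translates avoid all earlier boxes, or at least
`k` of them avoid all later ones; either way there is a triangular family of size `k`. -/
theorem hasMatches_of_hasSpread {d q n r k : ℕ} {σ : Labeling d q n} {b : Fin d → ℤ} (hr : 1 < r)
    (h : HasSpread n r (2 * k) (closedCorners r σ) b) :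
    HasMatches (r - 1) k ((60 * k + 2) * r) b σ := by
  classical
  obtain ⟨z, hz, hfar⟩ := h
  choose a t ha haz ht hta hmatch using fun j => exists_matches_of_mem_closedCorners hr (hz j).2.1
  have hcast : ((r - 1 : ℕ) : ℤ) = r - 1 := by omega
  -- two points in boxes with different indices are more than `r` apart in some coordinate
  have hsep : ∀ i j, i ≠ j → ∀ x ∈ box (a i) (r - 1), ∀ y ∈ box (a j) (r - 1), ¬ Near r x y := by
    intro i j hij x hx y hy hxy
    have hnear : Near (10 * r) (z i) (z j) := by
      intro c
      have h1 := haz i c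
      have h2 := haz j c
      have h3 := mem_box.1 hx c
      have h4 := mem_box.1 hy c
      have h5 := abs_le.1 (hxy c)
      rw [abs_le]
      omega
    rcases lt_or_gt_of_ne hij with h' | h'
    exacts [hfar i j h' hnear, hfar j i h' hnear.symm]
  have hdisj : ∀ i j, i ≠ j → Disjoint (box (a i) (r - 1)) (box (a j) (r - 1)) := fun i j hij =>
    Finset.disjoint_left.2 fun x hx hy => hsep i j hij x hx x hy (Near.refl (by positivity) x)
  have hone : ∀ l i j, i ≠ j → Disjoint (box (t l + a l) (r - 1)) (box (a i) (r - 1)) ∨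
      Disjoint (box (t l + a l) (r - 1)) (box (a j) (r - 1)) := by
    intro l i j hij
    by_contra! hcon
    obtain ⟨x, hx, hxi⟩ := Finset.not_disjoint_iff.1 hcon.1
    obtain ⟨y, hy, hyj⟩ := Finset.not_disjoint_iff.1 hcon.2
    refine hsep i j hij x hxi y hyj fun c => ?_
    have h1 := mem_box.1 hx c
    have h2 := mem_box.1 hy c
    rw [abs_le]
    omega
  have hnear : ∀ j, Near ((60 * k + 2) * r : ℕ) (a j) b := by
    intro j c
    have h1 := abs_le.1 ((hz j).2.2 c)
    have h2 := haz j c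
    have h3 : ((60 * k + 2 : ℕ) * r : ℤ) = 30 * (2 * k : ℕ) * r + 2 * r := by push_cast; ring
    push_cast at h1 h3 ⊢
    rw [abs_le]
    constructor <;> linarith
  have build : ∀ e : Fin k → Fin (2 * k), Function.Injective e →
      (∀ i j, i < j → Disjoint (box (t (e j) + a (e j)) (r - 1)) (box (a (e i)) (r - 1))) →
      HasMatches (r - 1) k ((60 * k + 2) * r) b σ := fun e he htri =>
    ⟨a ∘ e, t ∘ e, ⟨fun j => ht (e j), fun j => ha (e j), fun j => hta (e j),
      fun i j hij => hdisj _ _ (he.ne hij.ne), htri⟩, fun j => hnear (e j), fun j => hmatch (e j)⟩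
  let fwd : Finset (Fin (2 * k)) := Finset.univ.filter fun j =>
    ∀ i < j, Disjoint (box (t j + a j) (r - 1)) (box (a i) (r - 1))
  let bwd : Finset (Fin (2 * k)) := Finset.univ.filter fun j =>
    ∀ i > j, Disjoint (box (t j + a j) (r - 1)) (box (a i) (r - 1))
  have hcover : fwd ∪ bwd = Finset.univ := by
    refine Finset.eq_univ_iff_forall.2 fun l => ?_
    by_contra hl
    simp only [fwd, bwd, Finset.mem_union, Finset.mem_filter, Finset.mem_univ, true_and,
      not_or] at hl
    push Not at hl
    obtain ⟨⟨i, hi, hi'⟩, ⟨j, hj, hj'⟩⟩ := hl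
    rcases hone l i j (hi.trans hj).ne with h | h
    exacts [hi' h, hj' h]
  have hcard : 2 * k ≤ fwd.card + bwd.card := by
    have := Finset.card_union_le fwd bwd
    rwa [hcover, Finset.card_univ, Fintype.card_fin] at this
  by_cases hk : k ≤ fwd.card
  · let e := fwd.orderEmbOfCardLe hk
    refine build e e.injective fun i j hij => ?_
    exact (Finset.mem_filter.1 (fwd.orderEmbOfCardLe_mem hk j)).2 _ (e.strictMono hij)
  · let e := bwd.orderEmbOfCardLe (k := k) (by omega)
    refine build (e ∘ Fin.rev) (e.injective.comp Fin.rev_injective) fun i j hij => ?_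
    exact (Finset.mem_filter.1 (bwd.orderEmbOfCardLe_mem _ (Fin.rev j))).2 _
      (e.strictMono (Fin.rev_lt_rev.2 hij))

/-! ### The first moment bound -/

open Filter Topology

theorem tendsto_atTop_of_rpow_le {d q : ℕ} {ε : ℝ} (hd : 0 < d) (hε : 0 < ε) (hq : 1 ≤ q)
    {r : ℕ → ℕ} (h : ∀ᶠ n : ℕ in atTop, (n : ℝ) ^ ((d : ℝ) * (1 + ε)) ≤ (q : ℝ) ^ (r n ^ d)) :
    Tendsto r atTop atTop := by
  have hp : (0 : ℝ) < d * (1 + ε) := by positivity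
  refine tendsto_atTop.2 fun R => ?_
  filter_upwards [h, ((tendsto_rpow_atTop hp).comp tendsto_natCast_atTop_atTop).eventually_gt_atTop
    ((q : ℝ) ^ (R ^ d))] with n h1 h2
  by_contra! hR
  have h3 : (q : ℝ) ^ (r n ^ d) ≤ (q : ℝ) ^ (R ^ d) := by
    have : (1 : ℝ) ≤ q := by exact_mod_cast hq
    gcongr
  exact absurd (h2.trans_le (h1.trans h3)) (lt_irrefl _)

theorem two_le_of_rpow_le {d q : ℕ} {ε : ℝ} (hd : 0 < d) (hε : 0 < ε) (hq : 1 ≤ q)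
    {r : ℕ → ℕ} (h : ∀ᶠ n : ℕ in atTop, (n : ℝ) ^ ((d : ℝ) * (1 + ε)) ≤ (q : ℝ) ^ (r n ^ d)) :
    2 ≤ q := by
  have hp : (0 : ℝ) < d * (1 + ε) := by positivity
  obtain ⟨n, h1, h2⟩ := (h.and (((tendsto_rpow_atTop hp).comp
    tendsto_natCast_atTop_atTop).eventually_gt_atTop 1)).exists
  by_contra hq2
  obtain rfl : q = 1 := by omega
  rw [Nat.cast_one, one_pow] at h1
  exact absurd (h2.trans_le h1) (lt_irrefl _)

/-- The number of placements of a box and its translate, times the probability of a match, decays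
like a power of `n`: passing from `r ^ d` to `(r - 1) ^ d` and allowing a polynomial in `r` only
costs small powers of `q ^ (r ^ d)`. -/
theorem eventually_count_div_le {d q : ℕ} {ε : ℝ} (hd : 0 < d) (hε : 0 < ε) (hq : 1 ≤ q)
    {r : ℕ → ℕ} (h : ∀ᶠ n : ℕ in atTop, (n : ℝ) ^ ((d : ℝ) * (1 + ε)) ≤ (q : ℝ) ^ (r n ^ d))
    (M : ℕ) :
    ∀ᶠ n : ℕ in atTop, ((2 * (M * r n : ℕ) + 1 : ℝ) * (2 * n + 1)) ^ d /
      (q : ℝ) ^ (r n - 1) ^ d ≤ (n : ℝ) ^ (-(d * ε / 4)) := by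
  have hr := tendsto_atTop_of_rpow_le hd hε hq h
  have hq2 := two_le_of_rpow_le hd hε hq h
  have hq2' : (2 : ℝ) ≤ q := by exact_mod_cast hq2
  have hq0 : (0 : ℝ) < q := by linarith
  have hd' : (0 : ℝ) < d := by exact_mod_cast hd
  -- chosen so that `(1 + ε) (1 - 2 η) = 1 + ε / 2`
  set η : ℝ := ε / (4 * (1 + ε)) with hη
  have hη0 : 0 < η := by positivity
  have hexp : (d : ℝ) * (1 + ε) * (1 - 2 * η) = d * ε / 4 + d * ε / 4 + d := by
    rw [hη]; field_simp; ring
  have hη1 : 0 ≤ 1 - 2 * η := by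
    rw [hη, sub_nonneg, ← mul_div_assoc, div_le_one (by positivity)]
    linarith
  have hA : ∀ᶠ R : ℕ in atTop, (1 - η) * (R : ℝ) ^ d ≤ ((R - 1 : ℕ) : ℝ) ^ d := by
    filter_upwards [eventually_ge_atTop 1,
      tendsto_natCast_atTop_atTop.eventually_ge_atTop (d / η)] with R hR1 hR
    have hR0 : (0 : ℝ) < R := by exact_mod_cast hR1
    have hbern := one_add_mul_le_pow (a := -(1 / (R : ℝ))) (by
      have : 1 / (R : ℝ) ≤ 1 := by
        rw [div_le_one hR0]; exact_mod_cast hR1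
      linarith) d
    have h1 : (1 - η) ≤ (1 + -(1 / (R : ℝ))) ^ d := by
      refine le_trans ?_ hbern
      have : (d : ℝ) / R ≤ η := by
        rw [div_le_iff₀ hR0]
        rwa [div_le_iff₀ hη0, mul_comm] at hR
      have h2 : (d : ℝ) * -(1 / (R : ℝ)) = -(d / R) := by ring
      linarith
    calc (1 - η) * (R : ℝ) ^ d ≤ (1 + -(1 / (R : ℝ))) ^ d * (R : ℝ) ^ d := by gcongr
      _ = ((R - 1 : ℕ) : ℝ) ^ d := by
        rw [← mul_pow, Nat.cast_sub hR1]
        congr 1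
        field_simp
        push_cast
        ring
  have hB : ∀ᶠ R : ℕ in atTop, (2 * (M * R : ℕ) + 1 : ℝ) ^ d ≤ (q : ℝ) ^ (η * (R : ℝ) ^ d) := by
    have hbase : (1 : ℝ) < 2 ^ η := Real.one_lt_rpow one_lt_two hη0
    have hc : (0 : ℝ) < 1 / (2 * M + 1) ^ d := by positivity
    filter_upwards [eventually_ge_atTop 1,
      (isLittleO_pow_const_const_pow_of_one_lt (R := ℝ) d hbase).bound hc] with R hR1 hR
    have hR1' : (1 : ℝ) ≤ R := by exact_mod_cast hR1
    rw [Real.norm_of_nonneg (by positivity), Real.norm_of_nonneg (by positivity),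
      div_mul_eq_mul_div, one_mul, le_div_iff₀ (by positivity)] at hR
    calc (2 * (M * R : ℕ) + 1 : ℝ) ^ d ≤ (R * (2 * M + 1) : ℝ) ^ d := by
          push_cast
          gcongr
          nlinarith
      _ = (R : ℝ) ^ d * (2 * M + 1) ^ d := mul_pow _ _ _
      _ ≤ (2 ^ η) ^ R := hR
      _ = (2 : ℝ) ^ (η * R) := by rw [Real.rpow_mul zero_le_two, Real.rpow_natCast]
      _ ≤ (2 : ℝ) ^ (η * (R : ℝ) ^ d) := by
          refine Real.rpow_le_rpow_of_exponent_le one_le_two ?_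
          gcongr
          exact le_self_pow₀ hR1' hd.ne'
      _ ≤ (q : ℝ) ^ (η * (R : ℝ) ^ d) := by gcongr
  have hC : ∀ᶠ n : ℕ in atTop, (3 : ℝ) ^ d ≤ (n : ℝ) ^ (d * ε / 4 : ℝ) :=
    ((tendsto_rpow_atTop (by positivity)).comp tendsto_natCast_atTop_atTop).eventually_ge_atTop _
  filter_upwards [h, hr.eventually hA, hr.eventually hB, hC, eventually_ge_atTop 1]
    with n hn hAn hBn hCn hn1
  have hn0 : (0 : ℝ) < n := by exact_mod_cast hn1
  have hn1' : (1 : ℝ) ≤ n := by exact_mod_cast hn1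
  rw [Real.rpow_neg hn0.le, ← one_div, div_le_div_iff₀ (by positivity) (by positivity), one_mul]
  have hY : (n : ℝ) ^ (d * ε / 4) * (n : ℝ) ^ (d * ε / 4) * (n : ℝ) ^ d ≤
      (q : ℝ) ^ ((1 - 2 * η) * (r n : ℝ) ^ d) := by
    calc (n : ℝ) ^ (d * ε / 4) * (n : ℝ) ^ (d * ε / 4) * (n : ℝ) ^ d
        = ((n : ℝ) ^ ((d : ℝ) * (1 + ε))) ^ (1 - 2 * η) := by
          rw [← Real.rpow_mul hn0.le, hexp, Real.rpow_add hn0, Real.rpow_add hn0,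
            Real.rpow_natCast]
      _ ≤ ((q : ℝ) ^ (r n ^ d)) ^ (1 - 2 * η) := by gcongr
      _ = (q : ℝ) ^ ((1 - 2 * η) * (r n : ℝ) ^ d) := by
          rw [← Real.rpow_natCast, ← Real.rpow_mul hq0.le, mul_comm]
          push_cast
          rfl
  calc ((2 * (M * r n : ℕ) + 1 : ℝ) * (2 * n + 1)) ^ d * (n : ℝ) ^ (d * ε / 4)
      ≤ ((2 * (M * r n : ℕ) + 1 : ℝ) * (3 * n)) ^ d * (n : ℝ) ^ (d * ε / 4) := by
        gcongr
        linarith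
    _ = (2 * (M * r n : ℕ) + 1 : ℝ) ^ d *
          ((n : ℝ) ^ (d * ε / 4) * 3 ^ d * (n : ℝ) ^ d) := by
        rw [mul_pow, mul_pow]; ring
    _ ≤ (q : ℝ) ^ (η * (r n : ℝ) ^ d) *
          ((n : ℝ) ^ (d * ε / 4) * (n : ℝ) ^ (d * ε / 4) * (n : ℝ) ^ d) := by gcongr
    _ ≤ (q : ℝ) ^ (η * (r n : ℝ) ^ d) * (q : ℝ) ^ ((1 - 2 * η) * (r n : ℝ) ^ d) := by gcongr
    _ = (q : ℝ) ^ ((1 - η) * (r n : ℝ) ^ d) := by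
        rw [← Real.rpow_add hq0]
        congr 1
        ring
    _ ≤ (q : ℝ) ^ (((r n - 1 : ℕ) : ℝ) ^ d) :=
        Real.rpow_le_rpow_of_exponent_le (by linarith) hAn
    _ = (q : ℝ) ^ (r n - 1) ^ d := by
        rw [← Real.rpow_natCast (q : ℝ) ((r n - 1) ^ d), Nat.cast_pow]

/-- Somewhere in `Λ_n` there is a triangular family of `k` matching boxes within distance `ℓ₁`, or
some box within distance `ℓ₂` of an extreme grid corner matches a translate. -/
def badEvent (d q n r k ℓ₁ ℓ₂ : ℕ) : Set (Labeling d q n) :=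
  {σ | (∃ b ∈ Lam d n, HasMatches (r - 1) k ℓ₁ b σ) ∨
    ∃ c, IsExtreme n r c ∧ HasMatches (r - 1) 1 ℓ₂ c σ}

theorem labelLaw_real_badEvent_le {d q n r k ℓ₁ ℓ₂ : ℕ} [NeZero q] (hr : 1 < r) :
    (labelLaw d q n).real (badEvent d q n r k ℓ₁ ℓ₂) ≤
      (n : ℝ) ^ d * (((2 * ℓ₁ + 1 : ℝ) * (2 * n + 1)) ^ d / (q : ℝ) ^ (r - 1) ^ d) ^ k +
      2 ^ d * (((2 * ℓ₂ + 1 : ℝ) * (2 * n + 1)) ^ d / (q : ℝ) ^ (r - 1) ^ d) := by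
  classical
  let E : Finset (Fin d → ℤ) := Fintype.piFinset fun _ => {0, (n : ℤ) - 2 * r}
  have hE : (E.card : ℝ) ≤ 2 ^ d := by
    have : E.card ≤ 2 ^ d := by
      simp only [E, Fintype.card_piFinset, Finset.prod_const, Finset.card_univ, Fintype.card_fin]
      exact Nat.pow_le_pow_left Finset.card_le_two d
    exact_mod_cast this
  have hΛ : ((Lam d n).card : ℝ) = (n : ℝ) ^ d := by
    rw [Lam, card_box]; push_cast; rfl
  have hsub : badEvent d q n r k ℓ₁ ℓ₂ ⊆ (⋃ b ∈ Lam d n, {σ | HasMatches (r - 1) k ℓ₁ b σ}) ∪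
      ⋃ c ∈ E, {σ | HasMatches (r - 1) 1 ℓ₂ c σ} := by
    rintro σ (⟨b, hb, h⟩ | ⟨c, hc, h⟩)
    · exact Or.inl (Set.mem_biUnion hb h)
    · refine Or.inr (Set.mem_biUnion (x := c) (Fintype.mem_piFinset.2 fun i => ?_) h)
      rw [Finset.mem_insert, Finset.mem_singleton]
      exact hc i
  have hs : 0 < r - 1 := by omega
  refine (MeasureTheory.measureReal_mono hsub (MeasureTheory.measure_ne_top _ _)).trans
    ((MeasureTheory.measureReal_union_le _ _).trans (add_le_add ?_ ?_))
  · refine (MeasureTheory.measureReal_biUnion_finset_le _ _).trans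
      ((Finset.sum_le_sum fun b _ => labelLaw_real_hasMatches_le hs k ℓ₁ b).trans_eq ?_)
    rw [Finset.sum_const, nsmul_eq_mul, hΛ]
  · refine (MeasureTheory.measureReal_biUnion_finset_le _ _).trans
      ((Finset.sum_le_sum fun c _ => labelLaw_real_hasMatches_le hs 1 ℓ₂ c).trans ?_)
    rw [Finset.sum_const, nsmul_eq_mul, pow_one]
    gcongr

theorem tendsto_labelLaw_badEvent {d q : ℕ} {ε : ℝ} (hd : 0 < d) (hε : 0 < ε) (hq : 1 ≤ q)
    {r : ℕ → ℕ} (h : ∀ᶠ n : ℕ in atTop, (n : ℝ) ^ ((d : ℝ) * (1 + ε)) ≤ (q : ℝ) ^ (r n ^ d))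
    {k : ℕ} (hk : 4 / ε < k) (M₁ M₂ : ℕ) :
    Tendsto (fun n => (labelLaw d q n).real (badEvent d q n (r n) k (M₁ * r n) (M₂ * r n)))
      atTop (𝓝 0) := by
  have : NeZero q := ⟨by omega⟩
  have hd' : (0 : ℝ) < d := by exact_mod_cast hd
  have hexp : 0 < d * ε / 4 * k - d := by
    have : 4 < ε * k := by rwa [div_lt_iff₀ hε, mul_comm] at hk
    nlinarith
  have hlim : Tendsto (fun n : ℕ => (n : ℝ) ^ (-(d * ε / 4 * k - d)) +
      2 ^ d * (n : ℝ) ^ (-(d * ε / 4))) atTop (𝓝 0) := by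
    have h1 := (tendsto_rpow_neg_atTop hexp).comp tendsto_natCast_atTop_atTop
    have h2 := ((tendsto_rpow_neg_atTop (show 0 < d * ε / 4 by positivity)).comp
      tendsto_natCast_atTop_atTop).const_mul ((2 : ℝ) ^ d)
    simpa using h1.add h2
  refine tendsto_of_tendsto_of_tendsto_of_le_of_le' tendsto_const_nhds hlim
    (Eventually.of_forall fun n => MeasureTheory.measureReal_nonneg) ?_
  filter_upwards [eventually_count_div_le hd hε hq h M₁, eventually_count_div_le hd hε hq h M₂,
    (tendsto_atTop_of_rpow_le hd hε hq h).eventually_gt_atTop 1, eventually_ge_atTop 1]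
    with n h1 h2 hr hn
  have hn0 : (0 : ℝ) < n := by exact_mod_cast hn
  refine (labelLaw_real_badEvent_le hr).trans ?_
  have e : (n : ℝ) ^ (-(d * ε / 4 * k - d)) = (n : ℝ) ^ d * ((n : ℝ) ^ (-(d * ε / 4))) ^ k := by
    rw [← Real.rpow_natCast, ← Real.rpow_natCast, ← Real.rpow_mul hn0.le, ← Real.rpow_add hn0]
    congr 1
    ring
  rw [e]
  gcongr

theorem tendsto_labelLaw_one {d q : ℕ} (hq : 1 ≤ q) {G E : ∀ n, Set (Labeling d q n)}
    (hE : Tendsto (fun n => (labelLaw d q n).real (E n)) atTop (𝓝 0))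
    (hG : ∀ᶠ n in atTop, ∀ σ, σ ∉ E n → σ ∈ G n) :
    Tendsto (fun n => labelLaw d q n (G n)) atTop (𝓝 1) := by
  have : NeZero q := ⟨by omega⟩
  rw [← ENNReal.tendsto_toReal_iff (fun n => MeasureTheory.measure_ne_top _ _) ENNReal.one_ne_top,
    ENNReal.toReal_one]
  have hlim : Tendsto (fun n => 1 - (labelLaw d q n).real (E n)) atTop (𝓝 1) := by
    simpa using hE.const_sub 1
  refine tendsto_of_tendsto_of_tendsto_of_le_of_le' hlim tendsto_const_nhds ?_
    (Eventually.of_forall fun n => MeasureTheory.measureReal_le_one)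
  filter_upwards [hG] with n hn
  rw [← MeasureTheory.probReal_compl_eq_one_sub (Set.toFinite _).measurableSet]
  exact MeasureTheory.measureReal_mono hn (MeasureTheory.measure_ne_top _ _)

theorem not_hasSpread_of_notMem_badEvent {d q n r k ℓ₂ : ℕ} (hr : 1 < r) {σ : Labeling d q n}
    (hσ : σ ∉ badEvent d q n r k ((60 * k + 2) * r) ℓ₂) :
    ∀ b ∈ gridCorners d n r, ¬ HasSpread n r (2 * k) (closedCorners r σ) b := fun b hb h =>
  hσ (Or.inl ⟨b, mem_Lam.2 fun i => ⟨(hb i).1, by have := (hb i).2.1; omega⟩,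
    hasMatches_of_hasSpread hr h⟩)

theorem notMem_closedCorners_of_notMem_badEvent {d q n r k ℓ₁ T : ℕ} (hr : 1 < r)
    {σ : Labeling d q n} (hσ : σ ∉ badEvent d q n r k ℓ₁ ((60 * (2 * k) + 3 + T) * r)) :
    ∀ c, IsExtreme n r c → ∀ b ∈ gridCorners d n r,
      Near ((60 * (2 * k : ℕ) + 1 + T) * r) b c → b ∉ closedCorners r σ := by
  intro c hc b _ hbc hb
  refine hσ (Or.inr ⟨c, hc, ?_⟩)
  have := hasMatches_of_mem_closedCorners (ℓ := (60 * (2 * k) + 1 + T) * r) hr hb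
    (by exact_mod_cast hbc)
  convert this using 1
  ring

end Shotgun

theorem mainTheorem3 (d : ℕ) (hd : 2 ≤ d) (ε : ℝ) (hε : 0 < ε) :
    ∃ κ : ℝ, ∀ (q : ℕ) (_ : 1 ≤ q) (r : ℕ → ℕ)
      (_ : ∀ᶠ n : ℕ in Filter.atTop, 2 * r n ≤ n)
      (_ : ∀ᶠ n : ℕ in Filter.atTop, (n : ℝ) ^ ((d : ℝ) * (1 + ε)) ≤ (q : ℝ) ^ (r n ^ d)),
      Filter.Tendsto (fun n : ℕ => Shotgun.labelLaw d q n
          {σ | ∀ B ∈ Shotgun.gridBoxes d n (r n) \ Shotgun.cluster (r n) σ,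
            Metric.diam (Shotgun.vertexSet (Shotgun.weakComponent (r n)
              (Shotgun.gridBoxes d n (r n) \ Shotgun.cluster (r n) σ) B)) ≤ κ * r n})
        Filter.atTop (nhds 1) ∧
      ∀ κ' : ℝ, Filter.Tendsto (fun n : ℕ => Shotgun.labelLaw d q n
          {σ | Shotgun.corner d n (r n) κ' ⊆ Shotgun.vertexSet (Shotgun.cluster (r n) σ)})
        Filter.atTop (nhds 1) := by
  -- `k` independent matches beat the `n ^ d` choices of their location
  obtain ⟨k, hk⟩ := exists_nat_gt (4 / ε)
  refine ⟨120 * (2 * k : ℕ) + 4, fun q hq r hrn h => ?_⟩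
  have hd0 : 0 < d := by omega
  have hr := (Shotgun.tendsto_atTop_of_rpow_le hd0 hε hq h).eventually_gt_atTop 1
  have hbad : ∀ T : ℕ, _ := fun T => Shotgun.tendsto_labelLaw_badEvent hd0 hε hq h hk
    (60 * k + 2) (60 * (2 * k) + 3 + T)
  constructor
  · refine Shotgun.tendsto_labelLaw_one hq (hbad 0) ?_
    filter_upwards [hr, hrn] with n hr1 hrn σ hσ B hB
    refine Shotgun.diam_weakComponent_le hd (by omega) hrn
      (Shotgun.not_hasSpread_of_notMem_badEvent hr1 hσ) (fun b hb h0 => ?_) hB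
    exact Shotgun.notMem_closedCorners_of_notMem_badEvent hr1 hσ 0 (fun _ => Or.inl rfl) b hb
      (by simpa using h0)
  · intro κ'
    obtain ⟨T, hT⟩ := exists_nat_ge κ'
    refine Shotgun.tendsto_labelLaw_one hq (hbad T) ?_
    filter_upwards [hr, hrn] with n hr1 hrn σ hσ
    exact Shotgun.corner_subset_vertexSet_cluster hd (by omega) hrn hT
      (Shotgun.not_hasSpread_of_notMem_badEvent hr1 hσ)
      (Shotgun.notMem_closedCorners_of_notMem_badEvent hr1 hσ)
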